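/- Let $p$ be a prime, $r,t\ge 1$, let $S=\mathrm{GR}(p^r,t)$ be the Galois ring of characteristic $p^r$ and degree $t$ (that is, $S\cong\mathbb Z_{p^r}[x]/(f)$ with $f \bmod p$ irreducible of degree $t$ over $\mathbb F_p$), let $\sigma\in\mathrm{Aut}(S)$, and let $S[x;\sigma]$ be the skew polynomial ring with $xa=\sigma(a)x$ for $a\in S$. Order the terms of $S[x;\sigma]^2$ by $(1,0)\prec(0,1)\prec(x,0)\prec(0,x)\prec\cdots$, and write $\mathrm{lt}$ and $\mathrm{lm}$ for the leading term and the leading monomial (including its coefficient) of a pair. A left Gröbner basis of a left submodule $\mathcal M\subseteq S[x;\sigma]^2$ is a generating set $\mathcal B$ of $\mathcal M$ such that for every nonzero $(f,g)\in\mathcal M$ there are $(a,b)\in\mathcal B$ and $h\in S[x;\sigma]$ with $\mathrm{lm}(f,g)=h\cdot\mathrm{lm}(a,b)$. Given $u\in S[x;\sigma]$ and an integer $m\ge 1$, the skew Byrne–Fitzpatrick algorithm starts with $\mathcal B_0=\{(p^i,0):0\le i<r\}\cup\{(0,p^i):0\le i<r\}$ and, for $k=0,\dots,m-1$, computes for each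 $P=(f,g)\in\mathcal B_k$ the discrepancy $\zeta_P=(fu-g)_k$ (the coefficient of $x^k$) and forms $\mathcal B_{k+1}$ by replacing each $P\in\mathcal B_k$ as follows: if $\zeta_P=0$, then $P$ is kept; otherwise, if some $Q\in\mathcal B_k$ has $\mathrm{lt}(Q)\prec\mathrm{lt}(P)$ and $\zeta_Q\mid\zeta_P$, then $P$ is replaced by $P-qQ$ for some such $Q$ and some $q\in S$ with $\zeta_P=q\zeta_Q$; otherwise $P$ is replaced by $xP$. The output is $\mathcal B_m$. Theorem. The algorithm can always be carried out, and whichever choices of $Q$ and $q$ are made, for every $0\le k<m$ the set $\mathcal B_{k+1}$ obtained after step $k$ has exactly $2r$ elements and is a left Gröbner basis of the left module $$\mathcal M_{k+1}=\{(f,g)\in S[x;\sigma]^2 : fu\equiv g \bmod x^{k+1}\}.$$ In particular, the output $\mathcal B_m$ is a left Gröbner basis, with $2r$ elements, of $\mathcal M=\{(f,g): fu\equiv g\bmod x^m\}$. Moreover, the algorithm is implemented, with exactly the same possible outputs, by an explicit program on coefficient lists which, whichever choices are made, uses at most $K\,r\,m^2$ operations in $S$, where $K$ is an absolute constant. Here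 an addition, a subtraction, a multiplication, a division (finding $q$ with $a=qb$ when $b\mid a$), an application of $\sigma$, a test for zero, and the computation of a $p$-adic valuation each count as one operation in $S$; comparisons of degrees and of valuations, being comparisons of integers, are not counted. -/

import Mathlib

open SkewPolynomial

namespace SkewBF

/-! ### Galois rings and the skew polynomial ring of an automorphism -/

/-- `S` is (isomorphic to) the Galois ring `GR(p^r, t)`, i.e. to `(ℤ/p^r)[x]/(f)` where the
reduction of `f` modulo `p` is irreducible of degree `t` over `𝔽_p`; here `r` is positive. -/
def IsGaloisRing (p r t : ℕ) (S : Type*) [CommRing S] : Prop :=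
  ∃ (hr : r ≠ 0) (f : Polynomial (ZMod (p ^ r))),
    Irreducible (f.map (ZMod.castHom (dvd_pow_self p hr) (ZMod p))) ∧
    (f.map (ZMod.castHom (dvd_pow_self p hr) (ZMod p))).natDegree = t ∧
    Nonempty (S ≃+* AdjoinRoot f)

/-- The action of `ℕ` on `S` by the powers of the automorphism `σ`. With this action,
Mathlib's `SkewPolynomial S` carries the multiplication of `S[x; σ]`, where `x a = σ(a) x`. -/
@[reducible] def powAction {S : Type*} [CommRing S] (σ : S ≃+* S) :
    MulSemiringAction (Multiplicative ℕ) S :=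
  MulSemiringAction.compHom S (powersHom (S ≃+* S) σ)

/-- The twist of the skew polynomial ring attached to `powAction σ` is `σ`. -/
theorem phi_powAction {S : Type*} [CommRing S] (σ : S ≃+* S) (a : S) :
    (letI := powAction σ; (φ : S →+* S) a) = σ a := by
  change (powersHom (S ≃+* S) σ) (Multiplicative.ofAdd 1) a = σ a
  simp

/-- Pairs `(f, g)` of skew polynomials. -/
abbrev Pair (S : Type*) [CommRing S] := SkewPolynomial S × SkewPolynomial S

/-! ### Terms, the term order, leading terms and leading monomials -/

/-- The term `(xⁿ, 0)` is encoded as `(n, 0)` and `(0, xⁿ)` as `(n, 1)`; the lexicographic order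
is the term order `(1,0) ≺ (0,1) ≺ (x,0) ≺ (0,x) ≺ ⋯`. -/
abbrev Term := ℕ ×ₗ Fin 2

section Terms

variable {S : Type*} [CommRing S]

/-- The monomial `c` times the given term. -/
noncomputable def monomialPair (e : Term) (c : S) : Pair S :=
  if (ofLex e).2 = 0 then (monomial (ofLex e).1 c, 0) else (0, monomial (ofLex e).1 c)

/-- The coefficient of a pair at a term. -/
noncomputable def coeffAt (P : Pair S) (e : Term) : S :=
  if (ofLex e).2 = 0 then P.1.coeff (ofLex e).1 else P.2.coeff (ofLex e).1

/-- The terms occurring in a pair. -/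
def terms (P : Pair S) : Finset Term :=
  P.1.support.image (fun n => toLex (n, (0 : Fin 2))) ∪
    P.2.support.image (fun n => toLex (n, (1 : Fin 2)))

/-- The leading term of a pair (`⊥` for the zero pair). -/
def lt (P : Pair S) : WithBot Term := (terms P).max

/-- The leading monomial of a pair (`0` for the zero pair). -/
noncomputable def lm (P : Pair S) : Pair S :=
  WithBot.recBotCoe (C := fun _ => Pair S) 0 (fun e => monomialPair e (coeffAt P e)) (lt P)

end Terms

/-! ### The solution module and left Gröbner bases -/

section Modules

variable {S : Type*} [CommRing S] [MulSemiringAction (Multiplicative ℕ) S]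

/-- The left module of all `(f, g)` with `f u ≡ g mod x^m`. -/
noncomputable def solutionModule (u : SkewPolynomial S) (m : ℕ) :
    Submodule (SkewPolynomial S) (Pair S) where
  carrier := {P | ∃ h : SkewPolynomial S, P.1 * u - P.2 = h * (X : SkewPolynomial S) ^ m}
  zero_mem' := ⟨0, by simp⟩
  add_mem' := by
    rintro P Q ⟨h, hP⟩ ⟨h', hQ⟩
    refine ⟨h + h', ?_⟩
    rw [add_mul, ← hP, ← hQ, Prod.fst_add, Prod.snd_add, add_mul]
    abel
  smul_mem' := by
    rintro a P ⟨h, hP⟩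
    refine ⟨a * h, ?_⟩
    rw [mul_assoc, ← hP, Prod.smul_fst, Prod.smul_snd, smul_eq_mul, smul_eq_mul, mul_sub,
      mul_assoc]

/-- A left Gröbner basis: a generating set of the left module `M` such that the leading monomial
of every nonzero element of `M` is a left multiple of the leading monomial of a member of `B`. -/
def IsLeftGroebnerBasis (B : Set (Pair S)) (M : Submodule (SkewPolynomial S) (Pair S)) : Prop :=
  Submodule.span (SkewPolynomial S) B = M ∧
    ∀ P ∈ M, P ≠ 0 → ∃ Q ∈ B, ∃ h : SkewPolynomial S, lm P = h • lm Q

/-! ### The algorithm, on sets of pairs -/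

/-- The discrepancy `(f u - g)_k`. -/
noncomputable def discrepancy (u : SkewPolynomial S) (k : ℕ) (P : Pair S) : S :=
  (P.1 * u - P.2).coeff k

/-- The initial set `{(p^i, 0)} ∪ {(0, p^i)}`, `0 ≤ i < r`. -/
noncomputable def initialSet (S : Type*) [CommRing S] (p r : ℕ) : Set (Pair S) :=
  {P | ∃ i < r, P = (C ((p : S) ^ i), 0)} ∪ {P | ∃ i < r, P = (0, C ((p : S) ^ i))}

/-- The body of the inner loop: in step `k`, with current set `B`, the pair `P` may be replaced
by `P'`. -/
def Update (u : SkewPolynomial S) (k : ℕ) (B : Set (Pair S)) (P P' : Pair S) : Prop :=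
  (discrepancy u k P = 0 ∧ P' = P) ∨
  (discrepancy u k P ≠ 0 ∧ ∃ Q ∈ B, lt Q < lt P ∧
    ∃ q : S, discrepancy u k P = q * discrepancy u k Q ∧ P' = P - C q • Q) ∨
  (discrepancy u k P ≠ 0 ∧ (¬ ∃ Q ∈ B, lt Q < lt P ∧ discrepancy u k Q ∣ discrepancy u k P) ∧
    P' = (X : SkewPolynomial S) • P)

/-- Step `k` of the outer loop turns `B` into `B'`, for some admissible choices of the reducing
pairs and of the cofactors `q`. -/
def Step (u : SkewPolynomial S) (k : ℕ) (B B' : Set (Pair S)) : Prop :=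
  ∃ τ : Pair S → Pair S, (∀ P ∈ B, Update u k B P (τ P)) ∧ B' = τ '' B

/-- `B 0, B 1, …, B m` are the sets produced by an execution of the algorithm on `u` and `m`. -/
def IsRun (p r : ℕ) (u : SkewPolynomial S) (m : ℕ) (B : ℕ → Set (Pair S)) : Prop :=
  B 0 = initialSet S p r ∧ ∀ k < m, Step u k (B k) (B (k + 1))

end Modules

/-! ### Programs with a count of the operations in `S` -/

/-- A nondeterministic program with operation count: `x a c` means that `x` can return the value
`a` after exactly `c` operations in the ring. -/
def Prog (α : Type*) := α → ℕ → Prop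

namespace Prog

/-- Return a value, without any ring operation. -/
def ret {α : Type*} (a : α) : Prog α := fun b c => b = a ∧ c = 0

/-- Return any member of `s`, without any ring operation. -/
def anyOf {α : Type*} (s : Set α) : Prog α := fun b c => b ∈ s ∧ c = 0

/-- Return any member of `s`, at the cost of one ring operation. -/
def op {α : Type*} (s : Set α) : Prog α := fun b c => b ∈ s ∧ c = 1

/-- Sequential composition; the operation counts add up. -/
def bind {α β : Type*} (x : Prog α) (f : α → Prog β) : Prog β :=
  fun b c => ∃ a c₁ c₂, x a c₁ ∧ f a b c₂ ∧ c = c₁ + c₂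

/-- Run `f` on every entry of a list. -/
def forEach {α β : Type*} (f : α → Prog β) : List α → Prog (List β)
  | [] => ret []
  | a :: l => (f a).bind fun b => (forEach f l).bind fun bs => ret (b :: bs)

end Prog

section Program

variable {S : Type*} [CommRing S] [MulSemiringAction (Multiplicative ℕ) S]

/-- Valuation of `a` with respect to `p`, with value `r` at `0`. -/
noncomputable def valuation (p r : ℕ) (a : S) : ℕ :=
  open Classical in Nat.findGreatest (fun n => (p : S) ^ n ∣ a) r

/-! The operations in `S`, each counted once. -/

/-- Addition in `S`. -/
def opAdd (a b : S) : Prog S := Prog.op {a + b}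
/-- Subtraction in `S`. -/
def opSub (a b : S) : Prog S := Prog.op {a - b}
/-- Multiplication in `S`. -/
def opMul (a b : S) : Prog S := Prog.op {a * b}
/-- One application of the automorphism. -/
def opTwist (a : S) : Prog S := Prog.op {(φ : S →+* S) a}
/-- Division: any `q` with `a = q b`, if there is one. -/
def opQuo (a b : S) : Prog S := Prog.op {q | b ∣ a → a = q * b}
/-- Test for zero. -/
noncomputable def opIsZero (a : S) : Prog Bool :=
  open Classical in Prog.op {decide (a = 0)}
/-- Valuation. -/
noncomputable def opVal (p r : ℕ) (a : S) : Prog ℕ := Prog.op {valuation p r a}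

/-! Polynomials are stored as lists of coefficients, lowest degree first. -/

/-- The skew polynomial with the given list of coefficients. -/
noncomputable def toPoly (l : List S) : SkewPolynomial S :=
  ∑ i ∈ Finset.range l.length, monomial i (l.getD i 0)

/-- The pair of skew polynomials stored in a pair of lists. -/
noncomputable def toPair (P : List S × List S) : Pair S := (toPoly P.1, toPoly P.2)

/-- The sum of the products of corresponding entries. -/
def dot : List S → List S → Prog S
  | a :: as, b :: bs => (opMul a b).bind fun c => (dot as bs).bind fun d => opAdd c d
  | _, _ => Prog.ret 0

/-- The coefficients of `f - q g`. -/
def subMul (q : S) : List S → List S → Prog (List S)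
  | as, [] => Prog.ret as
  | [], b :: bs => (opMul q b).bind fun c => (opSub 0 c).bind fun d =>
      (subMul q [] bs).bind fun l => Prog.ret (d :: l)
  | a :: as, b :: bs => (opMul q b).bind fun c => (opSub a c).bind fun d =>
      (subMul q as bs).bind fun l => Prog.ret (d :: l)

/-- The coefficients of `x f`. -/
def shift (f : List S) : Prog (List S) :=
  (Prog.forEach opTwist f).bind fun l => Prog.ret (0 :: l)

/-- The degree, found by testing coefficients for zero. -/
noncomputable def degree : List S → Prog (WithBot ℕ)
  | [] => Prog.ret ⊥
  | a :: as => (degree as).bind fun d =>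
      WithBot.recBotCoe (C := fun _ => Prog (WithBot ℕ))
        ((opIsZero a).bind fun z => Prog.ret (if z = true then ⊥ else ((0 : ℕ) : WithBot ℕ)))
        (fun n => Prog.ret ((n + 1 : ℕ) : WithBot ℕ)) d

/-- The leading term of a stored pair. -/
noncomputable def leadingTerm (P : List S × List S) : Prog (WithBot Term) :=
  (degree P.1).bind fun d => (degree P.2).bind fun e =>
    Prog.ret (max (d.map fun n => (toLex (n, (0 : Fin 2)) : Term))
      (e.map fun n => (toLex (n, (1 : Fin 2)) : Term)))

/-- What the inner loop needs to know about a pair: the pair itself, its discrepancy, the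
valuation of the discrepancy, and the leading term of the pair. -/
structure Entry (S : Type*) where
  /-- the pair -/
  pair : List S × List S
  /-- its discrepancy -/
  disc : S
  /-- the valuation of the discrepancy -/
  val : ℕ
  /-- its leading term -/
  lead : WithBot Term

/-- Compute the data of a pair in step `k`. The list `T` holds the elements
`σ^j(u_{k-j})`, `0 ≤ j ≤ k`, so that `(f u)_k` is the sum of the `f_j T_j`. -/
noncomputable def examine (p r k : ℕ) (T : List S) (P : List S × List S) : Prog (Entry S) :=
  (dot P.1 T).bind fun a => (opSub a (P.2.getD k 0)).bind fun z =>
    (opVal p r z).bind fun v => (leadingTerm P).bind fun e => Prog.ret ⟨P, z, v, e⟩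

/-- The body of the inner loop. Whether there is a smaller pair whose discrepancy divides the
present one is read off from the leading terms and the valuations. -/
noncomputable def process (E : List (Entry S)) (R : Entry S) : Prog (List S × List S) :=
  (opIsZero R.disc).bind fun z =>
    open Classical in
    if z = true then Prog.ret R.pair
    else if ∃ Q ∈ E, Q.lead < R.lead ∧ Q.val ≤ R.val then
      (Prog.anyOf {Q | Q ∈ E ∧ Q.lead < R.lead ∧ Q.val ≤ R.val}).bind fun Q =>
        (opQuo R.disc Q.disc).bind fun q => (subMul q R.pair.1 Q.pair.1).bind fun f =>
          (subMul q R.pair.2 Q.pair.2).bind fun g => Prog.ret (f, g)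
    else (shift R.pair.1).bind fun f => (shift R.pair.2).bind fun g => Prog.ret (f, g)

/-- The list `a, a p, …, a p^(n-1)`. -/
def powers (p : ℕ) : ℕ → S → Prog (List S)
  | 0, _ => Prog.ret []
  | n + 1, a => (opMul a (p : S)).bind fun b => (powers p n b).bind fun l => Prog.ret (a :: l)

/-- The state of the program before step `k`: the list of the elements `σ^j(u_{k-j})`,
`0 ≤ j ≤ k`, and the list of the current pairs. -/
noncomputable def stateBefore (p r : ℕ) (u : SkewPolynomial S) :
    ℕ → Prog (List S × List (List S × List S))
  | 0 => (powers p r (1 : S)).bind fun l =>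
      Prog.ret ([u.coeff 0], l.map (fun a => ([a], [])) ++ l.map (fun a => ([], [a])))
  | k + 1 => (stateBefore p r u k).bind fun s =>
      (Prog.forEach (examine p r k s.1) s.2).bind fun E =>
        (Prog.forEach (process E) E).bind fun L =>
          (Prog.forEach opTwist s.1).bind fun T => Prog.ret (u.coeff (k + 1) :: T, L)

/-- The skew Byrne–Fitzpatrick algorithm on the input `u`, `m`. -/
noncomputable def skewByrneFitzpatrick (p r : ℕ) (u : SkewPolynomial S) (m : ℕ) :
    Prog (List (List S × List S)) :=
  (stateBefore p r u m).bind fun s => Prog.ret s.2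

end Program

end SkewBF

/-!
Of the Galois ring `S` only the following matters (`IsChainRing`): the element `p` is nilpotent of
order exactly `r`, and every element outside `p S` is invertible. Hence every element is a unit
times a power of `p`, divisibility is comparison of valuations, and the ideals of `S` form a chain.

*Correctness.* The set held by the algorithm is always a minimal family (`IsMinimalFamily`): for
each valuation `i < r` and each component `c` it has exactly one member whose leading coefficient
has valuation `i` and whose leading term lies in component `c`, and the degree of this leading term
is the least possible in the solution module. A minimal family has `2 r` members, and since the
leading monomial of every nonzero element of the module is a left multiple of that of the member
with the same valuation and component, it is a left Gröbner basis.

Minimality survives a step (`IsMinimalFamily.update`). On the `k`-th solution module the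
discrepancy of step `k` is `S`-linear and kills the multiples of `x`, so division with remainder by
the minimal family shows that the discrepancy of any element `R` is divisible by the discrepancy of
a member with leading term at most that of `R` (`IsMinimalFamily.exists_discrepancy_dvd`); here the
chain condition replaces an ideal generated by several discrepancies by a single one. A member that
is kept, or reduced by a smaller pair, keeps its leading monomial. If a member `P` is shifted, its
degree grows by one, and this is unavoidable (`IsMinimalFamily.lt_of_hasLead`): given a solution `R`
of the next congruence with the leading term of `P` and the same valuation, a difference `R - b P`
with `b` invertible has a smaller leading term and discrepancy `-b ζ_P`, so `ζ_P` would be divisible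
by the discrepancy of a smaller member.

*The program.* Apart from the choice of reducing pairs and cofactors, all parts of the program
return one value at one cost (`Prog.det`). Its test on leading terms and valuations is the test of
the algorithm on leading terms and divisibility, so the updates of stored pairs are those of the
algorithm (`update_of_process`, `exists_process_of_update`). The `2 r` pairs held by the algorithm
being distinct, updating the entries of a list independently amounts to applying one map to the set
of pairs (`step_of_forall₂`). Before step `k` the coefficient lists have length at most `k + 1`, so
the step costs `O(r (k + 1))` operations, and summing over `k < m` gives `O(r m²)`.
-/

/-! ### Galois rings as chain rings -/

namespace SkewBF

/-- `S` is a finite-length chain ring with uniformizer `p`: the element `p` is nilpotent of order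
exactly `r`, and every element outside `p S` is a unit. This is all that is used about Galois
rings. -/
structure IsChainRing (p r : ℕ) (S : Type*) [CommRing S] : Prop where
  pos : 0 < r
  pow_eq_zero : (p : S) ^ r = 0
  pow_ne_zero : (p : S) ^ (r - 1) ≠ 0
  isUnit : ∀ a : S, ¬ (p : S) ∣ a → IsUnit a

section ReductionModP

variable {p r : ℕ}

theorem castHom_eq_zero_iff [Fact p.Prime] (hr : r ≠ 0) (a : ZMod (p ^ r)) :
    ZMod.castHom (dvd_pow_self p hr) (ZMod p) a = 0 ↔ (p : ZMod (p ^ r)) ∣ a := by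
  have : NeZero (p ^ r) := ⟨pow_ne_zero _ (Fact.out : p.Prime).ne_zero⟩
  constructor
  · intro h
    rw [← ZMod.natCast_zmod_val a, map_natCast, ZMod.natCast_eq_zero_iff] at h
    obtain ⟨b, hb⟩ := h
    exact ⟨b, by rw [← ZMod.natCast_zmod_val a, hb]; push_cast; rfl⟩
  · rintro ⟨b, rfl⟩
    rw [map_mul, map_natCast, CharP.cast_eq_zero, zero_mul]

theorem pow_pred_mul_eq_zero_iff [Fact p.Prime] (hr : r ≠ 0) (a : ZMod (p ^ r)) :
    (p : ZMod (p ^ r)) ^ (r - 1) * a = 0 ↔ (p : ZMod (p ^ r)) ∣ a := by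
  have hp : p ≠ 0 := (Fact.out : p.Prime).ne_zero
  have : NeZero (p ^ r) := ⟨pow_ne_zero _ hp⟩
  obtain ⟨s, rfl⟩ := Nat.exists_eq_succ_of_ne_zero hr
  have hz : (p : ZMod (p ^ (s + 1))) ^ (s + 1) = 0 := by exact_mod_cast ZMod.natCast_self _
  constructor
  · intro h
    rw [← ZMod.natCast_zmod_val a, ← Nat.cast_pow, ← Nat.cast_mul, ZMod.natCast_eq_zero_iff] at h
    have h' : p ^ s * p ∣ p ^ s * a.val := by simpa [pow_succ] using h
    obtain ⟨b, hb⟩ := Nat.dvd_of_mul_dvd_mul_left (pow_pos (Nat.pos_of_ne_zero hp) s) h'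
    exact ⟨b, by rw [← ZMod.natCast_zmod_val a, hb]; push_cast; rfl⟩
  · rintro ⟨b, rfl⟩
    rw [← mul_assoc, Nat.succ_sub_one, ← pow_succ, hz, zero_mul]

open Polynomial in
theorem map_castHom_eq_zero_iff [Fact p.Prime] (hr : r ≠ 0) (g : (ZMod (p ^ r))[X]) :
    g.map (ZMod.castHom (dvd_pow_self p hr) (ZMod p)) = 0 ↔ (p : (ZMod (p ^ r))[X]) ∣ g := by
  rw [← map_natCast (Polynomial.C : ZMod (p ^ r) →+* _) p, Polynomial.C_dvd_iff_dvd_coeff,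
    Polynomial.ext_iff]
  simp only [Polynomial.coeff_map, Polynomial.coeff_zero, castHom_eq_zero_iff hr]

open Polynomial in
theorem pow_pred_mul_polynomial_eq_zero_iff [Fact p.Prime] (hr : r ≠ 0) (g : (ZMod (p ^ r))[X]) :
    (p : (ZMod (p ^ r))[X]) ^ (r - 1) * g = 0 ↔
      g.map (ZMod.castHom (dvd_pow_self p hr) (ZMod p)) = 0 := by
  rw [map_castHom_eq_zero_iff hr, ← map_natCast (Polynomial.C : ZMod (p ^ r) →+* _) p,
    Polynomial.C_dvd_iff_dvd_coeff, Polynomial.ext_iff, ← Polynomial.C_pow]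
  simp only [Polynomial.coeff_C_mul, Polynomial.coeff_zero, pow_pred_mul_eq_zero_iff hr]

end ReductionModP

theorem IsChainRing.of_ringEquiv {p r : ℕ} {S T : Type*} [CommRing S] [CommRing T] (e : S ≃+* T)
    (h : IsChainRing p r T) : IsChainRing p r S where
  pos := h.pos
  pow_eq_zero := e.injective (by simpa using h.pow_eq_zero)
  pow_ne_zero h0 := h.pow_ne_zero (by simpa using congrArg e h0)
  isUnit a ha := by
    have := h.isUnit (e a) fun hd => ha (by simpa using map_dvd e.symm hd)
    simpa using this.map e.symm

theorem natCast_pow_adjoinRoot_eq_zero {p r : ℕ} (f : Polynomial (ZMod (p ^ r))) :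
    (p : AdjoinRoot f) ^ r = 0 := by
  have := congrArg (AdjoinRoot.of f) (ZMod.natCast_self (p ^ r))
  rwa [map_natCast, map_zero, Nat.cast_pow] at this

/-- If `f h = p^(r-1)`, then `h` is divisible by `p^j` for all `j < r`, one factor `p` at a time,
because `f` is nonzero modulo `p`; hence `f` would be invertible modulo `p`. -/
theorem natCast_pow_pred_adjoinRoot_ne_zero {p r : ℕ} [Fact p.Prime] (hr : r ≠ 0)
    (f : Polynomial (ZMod (p ^ r)))
    (hf : Irreducible (f.map (ZMod.castHom (dvd_pow_self p hr) (ZMod p)))) :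
    (p : AdjoinRoot f) ^ (r - 1) ≠ 0 := by
  intro h0
  have h1 : AdjoinRoot.mk f ((p : Polynomial (ZMod (p ^ r))) ^ (r - 1)) = 0 := by simpa using h0
  obtain ⟨h, hh⟩ := AdjoinRoot.mk_eq_zero.mp h1
  have hz : (p : Polynomial (ZMod (p ^ r))) ^ r = 0 := by
    have := congrArg Polynomial.C (ZMod.natCast_self (p ^ r))
    rwa [map_natCast, map_zero, Nat.cast_pow] at this
  have key : ∀ j ≤ r - 1, (p : Polynomial (ZMod (p ^ r))) ^ j ∣ h := by
    intro j
    induction j with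
    | zero => simp
    | succ j ih =>
      intro hj
      obtain ⟨g, rfl⟩ := ih (by omega)
      have h2 : (p : Polynomial (ZMod (p ^ r))) ^ (r - 1) * (f * g) = 0 := by
        have e1 : r - 1 = (r - 1 - j) + j := by omega
        have e2 : r - 1 - j + (r - 1) = r + (r - 1 - j - 1) := by omega
        calc (p : Polynomial (ZMod (p ^ r))) ^ (r - 1) * (f * g)
            = (p : Polynomial (ZMod (p ^ r))) ^ (r - 1 - j) *
                (f * ((p : Polynomial _) ^ j * g)) := by
              conv_lhs => rw [e1, pow_add]
              ring
          _ = 0 := by rw [← hh, ← pow_add, e2, pow_add, hz, zero_mul]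
      rw [pow_pred_mul_polynomial_eq_zero_iff hr, Polynomial.map_mul, mul_eq_zero] at h2
      obtain ⟨g', rfl⟩ := (map_castHom_eq_zero_iff hr g).mp (h2.resolve_left hf.ne_zero)
      exact ⟨g', by ring⟩
  obtain ⟨g, rfl⟩ := key _ le_rfl
  have h3 : (p : Polynomial (ZMod (p ^ r))) ^ (r - 1) * (f * g - 1) = 0 := by
    linear_combination -hh
  rw [pow_pred_mul_polynomial_eq_zero_iff hr, Polynomial.map_sub, Polynomial.map_mul,
    Polynomial.map_one, sub_eq_zero] at h3
  exact hf.not_isUnit (IsUnit.of_mul_eq_one _ h3)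

/-- A Bézout relation modulo `p` lifts to an inverse up to the nilpotent element `p`. -/
theorem isUnit_adjoinRoot_of_not_dvd {p r : ℕ} [Fact p.Prime] (hr : r ≠ 0)
    (f : Polynomial (ZMod (p ^ r)))
    (hf : Irreducible (f.map (ZMod.castHom (dvd_pow_self p hr) (ZMod p))))
    (a : AdjoinRoot f) (ha : ¬ (p : AdjoinRoot f) ∣ a) : IsUnit a := by
  set ψ := ZMod.castHom (dvd_pow_self p hr) (ZMod p) with hψ
  have hsurj : Function.Surjective (Polynomial.map ψ) :=
    Polynomial.map_surjective ψ (ZMod.castHom_surjective _)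
  obtain ⟨g, rfl⟩ := AdjoinRoot.mk_surjective a
  by_cases hd : f.map ψ ∣ g.map ψ
  · obtain ⟨h, hh⟩ := hd
    obtain ⟨h, rfl⟩ := hsurj h
    have : (g - f * h).map ψ = 0 := by
      rw [Polynomial.map_sub, Polynomial.map_mul, hh, sub_self]
    obtain ⟨c, hc⟩ := (map_castHom_eq_zero_iff hr _).mp this
    refine absurd ⟨AdjoinRoot.mk f c, ?_⟩ ha
    have h1 := congrArg (AdjoinRoot.mk f) hc
    simpa using h1
  · obtain ⟨x, y, hxy⟩ := (hf.coprime_iff_not_dvd.mpr hd)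
    obtain ⟨x, rfl⟩ := hsurj x
    obtain ⟨y, rfl⟩ := hsurj y
    have : (y * g + x * f - 1).map ψ = 0 := by
      simp only [Polynomial.map_sub, Polynomial.map_add, Polynomial.map_mul, Polynomial.map_one]
      linear_combination hxy
    obtain ⟨c, hc⟩ := (map_castHom_eq_zero_iff hr _).mp this
    have h1 := congrArg (AdjoinRoot.mk f) hc
    simp only [map_sub, map_add, map_mul, map_one, AdjoinRoot.mk_self, mul_zero, add_zero,
      map_natCast] at h1
    have hn : IsNilpotent ((p : AdjoinRoot f) * AdjoinRoot.mk f c) :=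
      ⟨r, by rw [mul_pow, natCast_pow_adjoinRoot_eq_zero, zero_mul]⟩
    have h2 : IsUnit (AdjoinRoot.mk f y * AdjoinRoot.mk f g) := by
      rw [eq_add_of_sub_eq h1]
      exact hn.isUnit_add_one
    exact isUnit_of_mul_isUnit_right h2

theorem IsGaloisRing.isChainRing {p r t : ℕ} [Fact p.Prime] {S : Type*} [CommRing S]
    (h : IsGaloisRing p r t S) : IsChainRing p r S := by
  obtain ⟨hr, f, hf, -, ⟨e⟩⟩ := h
  exact .of_ringEquiv e
    { pos := Nat.pos_of_ne_zero hr
      pow_eq_zero := natCast_pow_adjoinRoot_eq_zero f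
      pow_ne_zero := natCast_pow_pred_adjoinRoot_ne_zero hr f hf
      isUnit := isUnit_adjoinRoot_of_not_dvd hr f hf }

namespace IsChainRing

variable {p r : ℕ} {S : Type*} [CommRing S]

theorem pow_valuation_dvd (a : S) : (p : S) ^ valuation p r a ∣ a := by
  classical
  rw [valuation]
  exact Nat.findGreatest_spec (P := fun n => (p : S) ^ n ∣ a) (Nat.zero_le r) (by simp)

theorem le_valuation {a : S} {i : ℕ} (hi : i ≤ r) (h : (p : S) ^ i ∣ a) : i ≤ valuation p r a := by
  classical
  rw [valuation]
  exact Nat.le_findGreatest hi h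

theorem valuation_le (a : S) : valuation p r a ≤ r := by
  classical
  rw [valuation]
  exact Nat.findGreatest_le r

theorem exists_isUnit_mul_pow (h : IsChainRing p r S) (a : S) :
    ∃ w : S, IsUnit w ∧ a = w * (p : S) ^ valuation p r a := by
  obtain ⟨b, hb⟩ := pow_valuation_dvd (p := p) (r := r) a
  rcases (valuation_le (p := p) (r := r) a).lt_or_eq with hv | hv
  · refine ⟨b, h.isUnit b ?_, by rw [mul_comm]; exact hb⟩
    rintro ⟨c, rfl⟩
    have := le_valuation (p := p) (r := r) (a := a) (i := valuation p r a + 1) hv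
      ⟨c, by rw [pow_succ, mul_assoc]; exact hb⟩
    omega
  · refine ⟨1, isUnit_one, ?_⟩
    rw [hv, h.pow_eq_zero, mul_zero, hb, hv, h.pow_eq_zero, zero_mul]

theorem valuation_lt_iff (h : IsChainRing p r S) {a : S} : valuation p r a < r ↔ a ≠ 0 := by
  constructor
  · rintro hv rfl
    exact absurd (le_valuation (p := p) (a := (0 : S)) le_rfl (dvd_zero _)) (not_le.mpr hv)
  · intro ha
    refine (valuation_le a).lt_of_ne fun hv => ha ?_
    obtain ⟨b, hb⟩ := pow_valuation_dvd (p := p) (r := r) a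
    rw [hb, hv, h.pow_eq_zero, zero_mul]

theorem dvd_iff (h : IsChainRing p r S) {a b : S} :
    a ∣ b ↔ valuation p r a ≤ valuation p r b := by
  constructor
  · intro hab
    exact le_valuation (valuation_le a) ((pow_valuation_dvd a).trans hab)
  · intro hv
    obtain ⟨w, hw, ha⟩ := h.exists_isUnit_mul_pow a
    rw [ha, hw.mul_left_dvd]
    exact (pow_dvd_pow _ hv).trans (pow_valuation_dvd b)

theorem dvd_total (h : IsChainRing p r S) (a b : S) : a ∣ b ∨ b ∣ a := by
  rw [h.dvd_iff, h.dvd_iff]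
  exact le_total _ _

theorem valuation_unit_mul_pow (h : IsChainRing p r S) {w : S} (hw : IsUnit w) {i : ℕ}
    (hi : i < r) : valuation p r (w * (p : S) ^ i) = i := by
  refine le_antisymm ?_ (le_valuation hi.le (dvd_mul_left _ _))
  by_contra! hlt
  have h1 : (p : S) ^ (i + 1) ∣ (p : S) ^ i := by
    rw [← hw.dvd_mul_left]
    exact (pow_dvd_pow _ hlt).trans (pow_valuation_dvd (r := r) _)
  have h2 : (p : S) ^ (r - 1 - i) * (p : S) ^ (i + 1) ∣ (p : S) ^ (r - 1 - i) * (p : S) ^ i :=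
    mul_dvd_mul_left _ h1
  rw [← pow_add, ← pow_add, show r - 1 - i + (i + 1) = r by omega,
    show r - 1 - i + i = r - 1 by omega, h.pow_eq_zero, zero_dvd_iff] at h2
  exact h.pow_ne_zero h2

theorem unit_mul_pow_ne_zero (h : IsChainRing p r S) {w : S} (hw : IsUnit w) {i : ℕ}
    (hi : i < r) : w * (p : S) ^ i ≠ 0 := by
  rw [← h.valuation_lt_iff, h.valuation_unit_mul_pow hw hi]
  exact hi

end IsChainRing

end SkewBF

/-! ### Coefficients of skew polynomials and of pairs -/

namespace SkewBF

section SkewCoeff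

variable {S : Type*} [CommRing S] [MulSemiringAction (Multiplicative ℕ) S]

theorem coeff_skew_mul (f g : SkewPolynomial S) (n : ℕ) :
    (f * g).coeff n =
      ∑ j ∈ Finset.range (n + 1), f.coeff j * (φ : S →+* S)^[j] (g.coeff (n - j)) := by
  classical
  rw [SkewPolynomial.coeff, SkewMonoidAlgebra.coeff_mul_antidiagonal_of_finset f g
    (Multiplicative.ofAdd n) ((Finset.HasAntidiagonal.antidiagonal n).map
      ⟨fun x => (Multiplicative.ofAdd x.1, Multiplicative.ofAdd x.2), fun x y h => by
        simpa [Prod.ext_iff] using h⟩)]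
  · rw [Finset.sum_map, Finset.Nat.sum_antidiagonal_eq_sum_range_succ_mk]
    exact Finset.sum_congr rfl fun j _ => by rw [φ_iterate_apply]; rfl
  · rintro ⟨a, b⟩
    simp only [Finset.mem_map, Prod.exists, Finset.HasAntidiagonal.mem_antidiagonal]
    constructor
    · rintro ⟨x, y, rfl, h⟩
      cases h
      rfl
    · intro h
      exact ⟨a.toAdd, b.toAdd, congrArg Multiplicative.toAdd h, rfl⟩

theorem coeff_monomial_mul_add (j n : ℕ) (b : S) (f : SkewPolynomial S) :
    (monomial j b * f).coeff (n + j) = b * (φ : S →+* S)^[j] (f.coeff n) := by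
  rw [coeff_skew_mul, Finset.sum_eq_single j]
  · simp [coeff_monomial]
  · intro i _ hi
    simp [coeff_monomial, hi.symm]
  · simp

theorem coeff_monomial_mul_of_lt {j n : ℕ} (h : n < j) (b : S) (f : SkewPolynomial S) :
    (monomial j b * f).coeff n = 0 := by
  rw [coeff_skew_mul]
  refine Finset.sum_eq_zero fun i hi => ?_
  have : j ≠ i := by rw [Finset.mem_range] at hi; omega
  simp [coeff_monomial, this]

theorem coeff_mul_X_pow_of_lt (f : SkewPolynomial S) {k n : ℕ} (h : n < k) :
    (f * (X : SkewPolynomial S) ^ k).coeff n = 0 := by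
  rw [coeff_skew_mul]
  refine Finset.sum_eq_zero fun i hi => ?_
  have : k ≠ n - i := by omega
  simp [X_pow_eq_monomial, coeff_monomial, this]

/-- A skew polynomial is a left multiple of `x ^ k` exactly if its coefficients below degree `k`
vanish. -/
theorem exists_eq_mul_X_pow_iff (f : SkewPolynomial S) (k : ℕ) :
    (∃ h : SkewPolynomial S, f = h * (X : SkewPolynomial S) ^ k) ↔ ∀ j < k, f.coeff j = 0 := by
  constructor
  · rintro ⟨h, rfl⟩ j hj
    exact coeff_mul_X_pow_of_lt h hj
  · intro hf
    refine ⟨∑ n ∈ f.support, monomial (n - k) (f.coeff n), ?_⟩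
    conv_lhs => rw [← sum_monomial f, SkewPolynomial.sum_def]
    rw [Finset.sum_mul]
    refine Finset.sum_congr rfl fun n hn => ?_
    have : k ≤ n := by
      by_contra! hlt
      exact mem_support_iff.mp hn (hf n hlt)
    rw [monomial_mul_X_pow, Nat.sub_add_cancel this]

end SkewCoeff

section PairCoeff

variable {S : Type*} [CommRing S]

theorem coeffAt_zero_right (P : Pair S) (n : ℕ) : coeffAt P (toLex (n, 0)) = P.1.coeff n := by
  simp [coeffAt]

theorem coeffAt_one_right (P : Pair S) (n : ℕ) : coeffAt P (toLex (n, 1)) = P.2.coeff n := by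
  simp [coeffAt]

/-- Case distinction on the component of a term. -/
theorem Term.cases {motive : Term → Prop} (h0 : ∀ n, motive (toLex (n, 0)))
    (h1 : ∀ n, motive (toLex (n, 1))) (e : Term) : motive e := by
  obtain ⟨⟨n, c⟩, rfl⟩ := toLex.surjective e
  fin_cases c
  · exact h0 n
  · exact h1 n

theorem coeffAt_zero (e : Term) : coeffAt (0 : Pair S) e = 0 := by
  simp [coeffAt]

theorem coeffAt_sub (P Q : Pair S) (e : Term) :
    coeffAt (P - Q) e = coeffAt P e - coeffAt Q e := by
  induction e using Term.cases <;>
    simp [coeffAt_zero_right, coeffAt_one_right]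

theorem pair_ext {P Q : Pair S} (h : ∀ e, coeffAt P e = coeffAt Q e) : P = Q := by
  refine Prod.ext (SkewPolynomial.ext fun n => ?_) (SkewPolynomial.ext fun n => ?_)
  · simpa [coeffAt_zero_right] using h (toLex (n, 0))
  · simpa [coeffAt_one_right] using h (toLex (n, 1))

theorem mem_terms {P : Pair S} {e : Term} : e ∈ terms P ↔ coeffAt P e ≠ 0 := by
  induction e using Term.cases <;>
    simp [coeffAt_zero_right, coeffAt_one_right, terms]

theorem lt_lt_coe_iff {P : Pair S} {e : Term} :
    lt P < (e : WithBot Term) ↔ ∀ e', e ≤ e' → coeffAt P e' = 0 := by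
  rw [lt, Finset.max_eq_sup_withBot, Finset.sup_lt_iff (WithBot.bot_lt_coe e)]
  constructor
  · intro h e' he
    by_contra hne
    exact absurd (WithBot.coe_lt_coe.mp (h e' (mem_terms.mpr hne))) (not_lt.mpr he)
  · intro h e' he
    rw [WithBot.coe_lt_coe]
    by_contra! hle
    exact mem_terms.mp he (h e' hle)

/-- The leading term is determined by the terms above it, in the form in which the program finds
it. -/
theorem eq_lt_of_forall {P : Pair S} {d : WithBot Term}
    (h : ∀ e : Term, d < (e : WithBot Term) ↔ ∀ e', e ≤ e' → coeffAt P e' = 0) : d = lt P := by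
  have h' : ∀ e : Term, d < (e : WithBot Term) ↔ lt P < (e : WithBot Term) := fun e => by
    rw [h, lt_lt_coe_iff]
  refine le_antisymm ?_ ?_
  · by_contra! hlt
    induction d with
    | bot => exact not_lt_bot hlt
    | coe d => exact lt_irrefl _ ((h' d).mpr hlt)
  · by_contra! hlt
    generalize lt P = q at *
    induction q with
    | bot => exact not_lt_bot hlt
    | coe q => exact lt_irrefl _ ((h' q).mp hlt)

/-- The leading monomial of the pair `P` is `a` times the term `e`. -/
def HasLead (P : Pair S) (e : Term) (a : S) : Prop :=
  a ≠ 0 ∧ coeffAt P e = a ∧ ∀ e', e < e' → coeffAt P e' = 0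

theorem HasLead.lt_eq {P : Pair S} {e : Term} {a : S} (h : HasLead P e a) :
    lt P = (e : WithBot Term) := by
  refine (eq_lt_of_forall fun e' => ?_).symm
  rw [WithBot.coe_lt_coe]
  constructor
  · intro he e'' he'
    exact h.2.2 _ (he.trans_le he')
  · intro h'
    by_contra! hle
    exact h.1 (h.2.1 ▸ h' e hle)

theorem HasLead.lm_eq {P : Pair S} {e : Term} {a : S} (h : HasLead P e a) :
    lm P = monomialPair e a := by
  rw [lm, h.lt_eq, WithBot.recBotCoe_coe, h.2.1]

theorem HasLead.unique {P : Pair S} {e e' : Term} {a a' : S} (h : HasLead P e a)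
    (h' : HasLead P e' a') : e = e' ∧ a = a' := by
  have he : e = e' := WithBot.coe_injective (h.lt_eq.symm.trans h'.lt_eq)
  subst he
  exact ⟨rfl, h.2.1.symm.trans h'.2.1⟩

theorem exists_hasLead {P : Pair S} (h : P ≠ 0) : ∃ e a, HasLead P e a := by
  have hne : (terms P).Nonempty := by
    by_contra! hemp
    refine h (pair_ext fun e => ?_)
    rw [coeffAt_zero]
    by_contra hc
    simpa [hemp] using mem_terms.mpr hc
  refine ⟨(terms P).max' hne, _, mem_terms.mp ((terms P).max'_mem hne), rfl, fun e he => ?_⟩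
  by_contra hc
  exact absurd ((terms P).le_max' e (mem_terms.mpr hc)) (not_le.mpr he)

theorem hasLead_monomialPair {e : Term} {a : S} (ha : a ≠ 0) : HasLead (monomialPair e a) e a := by
  obtain ⟨⟨n, c⟩, rfl⟩ := toLex.surjective e
  refine ⟨ha, ?_, fun e' he => ?_⟩
  · fin_cases c <;> simp [coeffAt, monomialPair, coeff_monomial]
  · obtain ⟨⟨n', c'⟩, rfl⟩ := toLex.surjective e'
    have hne := he.ne
    fin_cases c <;> fin_cases c' <;> simp_all [coeffAt, monomialPair, coeff_monomial]

/-- Subtracting a pair with a smaller leading term does not change the leading monomial. -/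
theorem HasLead.sub {P Q : Pair S} {e : Term} {a : S} (h : HasLead P e a)
    (hQ : lt Q < (e : WithBot Term)) : HasLead (P - Q) e a := by
  rw [lt_lt_coe_iff] at hQ
  refine ⟨h.1, ?_, fun e' he => ?_⟩
  · rw [coeffAt_sub, h.2.1, hQ e le_rfl, sub_zero]
  · rw [coeffAt_sub, h.2.2 e' he, hQ e' he.le, sub_zero]

theorem HasLead.sub_lt {P Q : Pair S} {e : Term} {a : S} (h : HasLead P e a)
    (hQ : HasLead Q e a) : lt (P - Q) < (e : WithBot Term) := by
  rw [lt_lt_coe_iff]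
  intro e' he
  rcases he.eq_or_lt with rfl | he
  · rw [coeffAt_sub, h.2.1, hQ.2.1, sub_self]
  · rw [coeffAt_sub, h.2.2 e' he, hQ.2.2 e' he, sub_zero]

variable [MulSemiringAction (Multiplicative ℕ) S]

theorem coeffAt_monomial_smul_add (j n : ℕ) (c : Fin 2) (b : S) (P : Pair S) :
    coeffAt ((monomial j b : SkewPolynomial S) • P) (toLex (n + j, c)) =
      b * (φ : S →+* S)^[j] (coeffAt P (toLex (n, c))) := by
  fin_cases c <;> simp [coeffAt, coeff_monomial_mul_add]

theorem coeffAt_monomial_smul_of_lt {j n : ℕ} (h : n < j) (c : Fin 2) (b : S) (P : Pair S) :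
    coeffAt ((monomial j b : SkewPolynomial S) • P) (toLex (n, c)) = 0 := by
  fin_cases c <;> simp [coeffAt, coeff_monomial_mul_of_lt h]

theorem monomial_smul_monomialPair (j n : ℕ) (c : Fin 2) (b a : S) :
    (monomial j b : SkewPolynomial S) • monomialPair (toLex (n, c)) a =
      monomialPair (toLex (n + j, c)) (b * (φ : S →+* S)^[j] a) := by
  fin_cases c <;> simp [monomialPair, monomial_mul_monomial, add_comm]

theorem HasLead.monomial_smul {P : Pair S} {n : ℕ} {c : Fin 2} {a : S}
    (h : HasLead P (toLex (n, c)) a) {j : ℕ} {b : S} (hb : b * (φ : S →+* S)^[j] a ≠ 0) :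
    HasLead ((monomial j b : SkewPolynomial S) • P) (toLex (n + j, c))
      (b * (φ : S →+* S)^[j] a) := by
  refine ⟨hb, by rw [coeffAt_monomial_smul_add, h.2.1], fun e he => ?_⟩
  obtain ⟨⟨n', c'⟩, rfl⟩ := toLex.surjective e
  rcases lt_or_ge n' j with hj | hj
  · exact coeffAt_monomial_smul_of_lt hj c' b P
  · obtain ⟨n'', rfl⟩ := Nat.exists_eq_add_of_le' hj
    rw [coeffAt_monomial_smul_add, h.2.2, iterate_map_zero, mul_zero]
    rw [Prod.Lex.toLex_lt_toLex] at he ⊢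
    simpa using he

theorem lt_C_smul_lt {P : Pair S} {e : WithBot Term} (h : lt P < e) (q : S) :
    lt ((C q : SkewPolynomial S) • P) < e := by
  induction e with
  | bot => exact absurd h not_lt_bot
  | coe e =>
    rw [lt_lt_coe_iff] at h ⊢
    intro e' he
    obtain ⟨⟨n, c⟩, rfl⟩ := toLex.surjective e'
    have := coeffAt_monomial_smul_add 0 n c q P
    rw [monomial_zero_left, Nat.add_zero] at this
    rw [this, h _ he, iterate_map_zero, mul_zero]

end PairCoeff

section Discrepancy

variable {S : Type*} [CommRing S] [MulSemiringAction (Multiplicative ℕ) S]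
variable {u : SkewPolynomial S} {k : ℕ}

theorem mem_solutionModule_iff {P : Pair S} :
    P ∈ solutionModule u k ↔ ∀ j < k, discrepancy u j P = 0 :=
  exists_eq_mul_X_pow_iff (P.1 * u - P.2) k

theorem mem_solutionModule_succ {P : Pair S} :
    P ∈ solutionModule u (k + 1) ↔ P ∈ solutionModule u k ∧ discrepancy u k P = 0 := by
  simp only [mem_solutionModule_iff, Nat.forall_lt_succ_right]

theorem discrepancy_sub (P Q : Pair S) :
    discrepancy u k (P - Q) = discrepancy u k P - discrepancy u k Q := by
  rw [discrepancy, discrepancy, discrepancy, ← SkewPolynomial.coeff_sub, Prod.fst_sub,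
    Prod.snd_sub, sub_mul]
  congr 1
  abel

theorem discrepancy_C_smul (b : S) (P : Pair S) :
    discrepancy u k ((C b : SkewPolynomial S) • P) = b * discrepancy u k P := by
  have := coeff_monomial_mul_add 0 k b (P.1 * u - P.2)
  rw [monomial_zero_left, Nat.add_zero, Function.iterate_zero, id] at this
  rw [discrepancy, discrepancy, ← this, mul_sub, ← mul_assoc]
  rfl

/-- On the `k`-th solution module the discrepancy of step `k` kills multiples of `x`. -/
theorem discrepancy_monomial_smul_of_pos {P : Pair S} (hP : P ∈ solutionModule u k) {j : ℕ}
    (hj : 0 < j) (b : S) :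
    discrepancy u k ((monomial j b : SkewPolynomial S) • P) = 0 := by
  have h1 : discrepancy u k ((monomial j b : SkewPolynomial S) • P) =
      (monomial j b * (P.1 * u - P.2)).coeff k := by
    rw [discrepancy, mul_sub, ← mul_assoc]
    rfl
  rw [h1]
  rcases lt_or_ge k j with h | h
  · exact coeff_monomial_mul_of_lt h _ _
  · obtain ⟨i, rfl⟩ := Nat.exists_eq_add_of_le' h
    have := mem_solutionModule_iff.mp hP i (by omega)
    rw [discrepancy] at this
    rw [coeff_monomial_mul_add, this, iterate_map_zero, mul_zero]

end Discrepancy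

end SkewBF

/-! ### Minimal families -/

namespace SkewBF

/-- The members of the initial set, indexed by valuation and component. -/
noncomputable def initialFamily (S : Type*) [CommRing S] (p r : ℕ) : Fin r × Fin 2 → Pair S :=
  fun x => monomialPair (toLex (0, x.2)) ((p : S) ^ (x.1 : ℕ))

theorem range_initialFamily {S : Type*} [CommRing S] {p r : ℕ} :
    Set.range (initialFamily S p r) = initialSet S p r := by
  ext P
  constructor
  · rintro ⟨⟨i, c⟩, rfl⟩
    fin_cases c
    · exact Or.inl ⟨i, i.2, by simp [initialFamily, monomialPair]⟩
    · exact Or.inr ⟨i, i.2, by simp [initialFamily, monomialPair]⟩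
  · rintro (⟨i, hi, rfl⟩ | ⟨i, hi, rfl⟩)
    · exact ⟨(⟨i, hi⟩, 0), by simp [initialFamily, monomialPair]⟩
    · exact ⟨(⟨i, hi⟩, 1), by simp [initialFamily, monomialPair]⟩

variable {S : Type*} [CommRing S] [MulSemiringAction (Multiplicative ℕ) S] {p r : ℕ}
  {u : SkewPolynomial S} {k : ℕ}

/-- A family of elements of `M`, one for each valuation `i < r` of the leading coefficient and each
component `c` of the leading term, whose degree `d (i, c)` is the least possible among the elements
of `M` whose leading monomial has valuation `i` and component `c`. -/
structure IsMinimalFamily (p : ℕ) {r : ℕ} (M : Submodule (SkewPolynomial S) (Pair S))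
    (F : Fin r × Fin 2 → Pair S) (d : Fin r × Fin 2 → ℕ) : Prop where
  mem : ∀ x, F x ∈ M
  lead : ∀ x, ∃ w : S, IsUnit w ∧ HasLead (F x) (toLex (d x, x.2)) (w * (p : S) ^ (x.1 : ℕ))
  le : ∀ x, ∀ R ∈ M, ∀ n a, HasLead R (toLex (n, x.2)) a → valuation p r a = x.1 → d x ≤ n

theorem iterate_twist_unit_mul_pow (j i : ℕ) (w : S) :
    (φ : S →+* S)^[j] (w * (p : S) ^ i) = (φ : S →+* S)^[j] w * (p : S) ^ i := by
  rw [← RingHom.coe_pow, map_mul, map_pow, map_natCast]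

theorem isUnit_iterate_twist (j : ℕ) {w : S} (hw : IsUnit w) :
    IsUnit ((φ : S →+* S)^[j] w) := by
  rw [← RingHom.coe_pow]
  exact hw.map _

namespace IsMinimalFamily

variable {M : Submodule (SkewPolynomial S) (Pair S)} {F : Fin r × Fin 2 → Pair S}
  {d : Fin r × Fin 2 → ℕ}

theorem lt_eq (hF : IsMinimalFamily p M F d) (x : Fin r × Fin 2) :
    lt (F x) = ((toLex (d x, x.2) : Term) : WithBot Term) := by
  obtain ⟨w, -, h⟩ := hF.lead x
  exact h.lt_eq

theorem injective (h : IsChainRing p r S) (hF : IsMinimalFamily p M F d) :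
    Function.Injective F := by
  intro x y hxy
  obtain ⟨w, hw, hx⟩ := hF.lead x
  obtain ⟨w', hw', hy⟩ := hF.lead y
  obtain ⟨h1, h2⟩ := hx.unique (hxy ▸ hy)
  have h3 := congrArg (valuation p r) h2
  rw [h.valuation_unit_mul_pow hw x.1.2, h.valuation_unit_mul_pow hw' y.1.2] at h3
  exact Prod.ext (Fin.ext h3) (congrArg (fun e => (ofLex e).2) h1)

theorem ncard_range (h : IsChainRing p r S) (hF : IsMinimalFamily p M F d) :
    (Set.range F).ncard = 2 * r := by
  rw [← Set.image_univ, Set.ncard_image_of_injective _ (hF.injective h), Set.ncard_univ]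
  simp [mul_comm]

/-- A member of the family has a left multiple, with invertible coefficient, with the same leading
monomial as a given nonzero element of `M`. -/
theorem exists_hasLead_smul (h : IsChainRing p r S) (hF : IsMinimalFamily p M F d) {R : Pair S}
    (hR : R ∈ M) {e : Term} {a : S} (hl : HasLead R e a) :
    ∃ x j b, IsUnit b ∧ toLex (d x + j, x.2) = e ∧
      HasLead ((monomial j b : SkewPolynomial S) • F x) e a ∧
      monomialPair e a = (monomial j b : SkewPolynomial S) • lm (F x) := by
  obtain ⟨⟨n, c⟩, rfl⟩ := toLex.surjective e
  obtain ⟨v, hv, ha⟩ := h.exists_isUnit_mul_pow a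
  -- the member with the valuation and the component of `R`
  set x : Fin r × Fin 2 := (⟨valuation p r a, h.valuation_lt_iff.mpr hl.1⟩, c) with hx
  obtain ⟨w, hw, hlx⟩ := hF.lead x
  obtain ⟨j, hj⟩ := Nat.exists_eq_add_of_le (hF.le x R hR n a hl rfl)
  obtain ⟨w', hw'⟩ := isUnit_iterate_twist j hw
  have hb : v * (w'⁻¹ : Sˣ) * (φ : S →+* S)^[j] (w * (p : S) ^ (x.1 : ℕ)) = a := by
    rw [iterate_twist_unit_mul_pow, ← hw', ← mul_assoc, mul_assoc v, Units.inv_mul, mul_one]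
    exact ha.symm
  refine ⟨x, j, v * (w'⁻¹ : Sˣ), hv.mul (Units.isUnit _), by rw [hj], ?_, ?_⟩
  · have := hlx.monomial_smul (j := j) (b := v * (w'⁻¹ : Sˣ)) (by rw [hb]; exact hl.1)
    rwa [hb, ← hj] at this
  · rw [hlx.lm_eq, monomial_smul_monomialPair, hb, hj]

theorem span_range (h : IsChainRing p r S) (hF : IsMinimalFamily p M F d) :
    Submodule.span (SkewPolynomial S) (Set.range F) = M := by
  refine le_antisymm (Submodule.span_le.mpr ?_) ?_
  · rintro _ ⟨x, rfl⟩
    exact hF.mem x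
  · suffices H : ∀ (T : WithBot Term) (R : Pair S), lt R = T → R ∈ M →
        R ∈ Submodule.span (SkewPolynomial S) (Set.range F) from fun R hR => H _ R rfl hR
    intro T
    induction T using WellFoundedLT.induction with
    | ind T ih =>
      intro R hT hR
      by_cases h0 : R = 0
      · rw [h0]
        exact Submodule.zero_mem _
      obtain ⟨e, a, hl⟩ := exists_hasLead h0
      obtain ⟨x, j, b, -, -, hb, -⟩ := hF.exists_hasLead_smul h hR hl
      have hs := Submodule.smul_mem (Submodule.span (SkewPolynomial S) (Set.range F))
        (monomial j b) (Submodule.subset_span (Set.mem_range_self x))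
      have := ih _ (by rw [← hT, hl.lt_eq]; exact hl.sub_lt hb) _ rfl
        (M.sub_mem hR (M.smul_mem (monomial j b) (hF.mem x)))
      simpa using add_mem this hs

theorem isLeftGroebnerBasis (h : IsChainRing p r S) (hF : IsMinimalFamily p M F d) :
    IsLeftGroebnerBasis (Set.range F) M := by
  refine ⟨hF.span_range h, fun R hR h0 => ?_⟩
  obtain ⟨e, a, hl⟩ := exists_hasLead h0
  obtain ⟨x, j, b, -, -, -, hb⟩ := hF.exists_hasLead_smul h hR hl
  exact ⟨F x, Set.mem_range_self x, monomial j b, by rw [hl.lm_eq, hb]⟩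

/-- The discrepancy of `R` lies in the ideal generated by the discrepancies of the members of the
family whose leading term is at most that of `R`. As the ideals of `S` form a chain, one of these
members suffices. -/
theorem exists_discrepancy_dvd (h : IsChainRing p r S)
    (hF : IsMinimalFamily p (solutionModule u k) F d) {R : Pair S}
    (hR : R ∈ solutionModule u k) :
    discrepancy u k R = 0 ∨ ∃ x, lt (F x) ≤ lt R ∧ discrepancy u k (F x) ∣ discrepancy u k R := by
  suffices H : ∀ (T : WithBot Term) (R : Pair S), lt R = T → R ∈ solutionModule u k →
      discrepancy u k R = 0 ∨ ∃ x, lt (F x) ≤ lt R ∧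
        discrepancy u k (F x) ∣ discrepancy u k R from H _ R rfl hR
  clear hR R
  intro T
  induction T using WellFoundedLT.induction with
  | ind T ih =>
    intro R hT hR
    by_cases h0 : R = 0
    · left
      simp [h0, discrepancy]
    obtain ⟨e, a, hl⟩ := exists_hasLead h0
    obtain ⟨x, j, b, -, he, hb, -⟩ := hF.exists_hasLead_smul h hR hl
    have hlt : lt (R - (monomial j b : SkewPolynomial S) • F x) < lt R := by
      rw [hl.lt_eq]
      exact hl.sub_lt hb
    have hx : lt (F x) ≤ lt R := by
      rw [hl.lt_eq, hF.lt_eq, WithBot.coe_le_coe, ← he, Prod.Lex.toLex_le_toLex]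
      simp only [lt_add_iff_pos_right]
      rcases Nat.eq_zero_or_pos j with rfl | hj
      · exact Or.inr ⟨rfl, le_rfl⟩
      · exact Or.inl hj
    have hd : discrepancy u k (F x) ∣
        discrepancy u k ((monomial j b : SkewPolynomial S) • F x) := by
      rcases Nat.eq_zero_or_pos j with rfl | hj
      · rw [monomial_zero_left, discrepancy_C_smul]
        exact dvd_mul_left _ _
      · rw [discrepancy_monomial_smul_of_pos (hF.mem x) hj]
        exact dvd_zero _
    have hsum : discrepancy u k R =
        discrepancy u k (R - (monomial j b : SkewPolynomial S) • F x) +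
          discrepancy u k ((monomial j b : SkewPolynomial S) • F x) := by
      rw [discrepancy_sub, sub_add_cancel]
    right
    -- `ζ_R` is the sum of a multiple of `ζ_(F x)` and of a term controlled by induction
    rcases ih _ (hT ▸ hlt) _ rfl (sub_mem hR (Submodule.smul_mem _ _ (hF.mem x))) with h1 | h1
    · exact ⟨x, hx, by rwa [hsum, h1, zero_add]⟩
    · obtain ⟨y, hy, hyd⟩ := h1
      rcases h.dvd_total (discrepancy u k (F x)) (discrepancy u k (F y)) with h2 | h2
      · exact ⟨x, hx, by rw [hsum]; exact dvd_add (h2.trans hyd) hd⟩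
      · exact ⟨y, hy.trans hlt.le, by rw [hsum]; exact dvd_add hyd (h2.trans hd)⟩

/-- If the member `F x` has to be shifted, then no element of the next solution module has the
leading term of `F x` together with the valuation of its leading coefficient: subtracting an
invertible multiple of `F x` would express its discrepancy by those of smaller pairs. -/
theorem lt_of_hasLead (h : IsChainRing p r S)
    (hF : IsMinimalFamily p (solutionModule u k) F d) {x : Fin r × Fin 2}
    (h0 : discrepancy u k (F x) ≠ 0)
    (hx : ¬ ∃ Q ∈ Set.range F, lt Q < lt (F x) ∧ discrepancy u k Q ∣ discrepancy u k (F x))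
    {R : Pair S} (hR : R ∈ solutionModule u (k + 1)) {n : ℕ} {a : S}
    (hl : HasLead R (toLex (n, x.2)) a) (ha : valuation p r a = x.1) : d x < n := by
  rw [mem_solutionModule_succ] at hR
  refine (hF.le x R hR.1 n a hl ha).lt_of_ne ?_
  rintro rfl
  obtain ⟨w, hw, hlx⟩ := hF.lead x
  obtain ⟨v, hv, hva⟩ := h.exists_isUnit_mul_pow a
  obtain ⟨w', rfl⟩ := hw
  -- `b` makes the leading monomials of `R` and `b F x` agree
  set b : S := v * (w'⁻¹ : Sˣ)
  have hba : b * (w' * (p : S) ^ (x.1 : ℕ)) = a := by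
    rw [hva, ha, ← mul_assoc, mul_assoc v, Units.inv_mul, mul_one]
  have hbl : HasLead ((C b : SkewPolynomial S) • F x) (toLex (d x, x.2)) a := by
    have := hlx.monomial_smul (j := 0) (b := b) (by
      rw [Function.iterate_zero, id, hba]; exact hl.1)
    rwa [Function.iterate_zero, id, hba] at this
  have hlt : lt (R - (C b : SkewPolynomial S) • F x) < lt (F x) := by
    rw [hF.lt_eq]
    exact hl.sub_lt hbl
  have hb : IsUnit b := hv.mul (Units.isUnit _)
  have hd : discrepancy u k (R - (C b : SkewPolynomial S) • F x) =
      -(b * discrepancy u k (F x)) := by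
    rw [discrepancy_sub, hR.2, discrepancy_C_smul, zero_sub]
  rcases hF.exists_discrepancy_dvd h
    (sub_mem hR.1 (Submodule.smul_mem _ (C b) (hF.mem x))) with h1 | ⟨y, hy, hyd⟩
  · rw [hd, neg_eq_zero, hb.mul_right_eq_zero] at h1
    exact h0 h1
  · rw [hd, dvd_neg, hb.dvd_mul_left] at hyd
    exact hx ⟨F y, Set.mem_range_self y, hy.trans_lt hlt, hyd⟩

/-- A step of the algorithm turns a minimal family of one solution module into a minimal family of
the next. -/
theorem update (h : IsChainRing p r S) (hF : IsMinimalFamily p (solutionModule u k) F d)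
    {F' : Fin r × Fin 2 → Pair S} (hF' : ∀ x, Update u k (Set.range F) (F x) (F' x)) :
    ∃ d', IsMinimalFamily p (solutionModule u (k + 1)) F' d' := by
  have H : ∀ x, ∃ n, F' x ∈ solutionModule u (k + 1) ∧
      (∃ w : S, IsUnit w ∧ HasLead (F' x) (toLex (n, x.2)) (w * (p : S) ^ (x.1 : ℕ))) ∧
      ∀ R ∈ solutionModule u (k + 1), ∀ m a, HasLead R (toLex (m, x.2)) a →
        valuation p r a = x.1 → n ≤ m := by
    intro x
    obtain ⟨w, hw, hl⟩ := hF.lead x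
    have hle : ∀ R ∈ solutionModule u (k + 1), ∀ m a, HasLead R (toLex (m, x.2)) a →
        valuation p r a = x.1 → d x ≤ m := fun R hR =>
      hF.le x R (mem_solutionModule_succ.mp hR).1
    rcases hF' x with ⟨h0, hP⟩ | ⟨-, Q, ⟨y, rfl⟩, hlt, q, hq, hP⟩ | ⟨h0, hno, hP⟩
    · rw [hP]
      exact ⟨d x, mem_solutionModule_succ.mpr ⟨hF.mem x, h0⟩, ⟨w, hw, hl⟩, hle⟩
    · rw [hP]
      refine ⟨d x, mem_solutionModule_succ.mpr ⟨?_, ?_⟩, ⟨w, hw, ?_⟩, hle⟩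
      · exact sub_mem (hF.mem x) (Submodule.smul_mem _ _ (hF.mem y))
      · rw [discrepancy_sub, discrepancy_C_smul, hq, sub_self]
      · refine hl.sub (lt_C_smul_lt ?_ q)
        rwa [hl.lt_eq] at hlt
    · rw [hP]
      refine ⟨d x + 1, mem_solutionModule_succ.mpr ⟨?_, ?_⟩,
        ⟨_, isUnit_iterate_twist 1 hw, ?_⟩, fun R hR m a hm ha =>
          hF.lt_of_hasLead h h0 hno hR hm ha⟩
      · exact Submodule.smul_mem _ _ (hF.mem x)
      · exact discrepancy_monomial_smul_of_pos (hF.mem x) one_pos 1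
      · have := hl.monomial_smul (j := 1) (b := (1 : S)) (by
          rw [one_mul, iterate_twist_unit_mul_pow]
          exact h.unit_mul_pow_ne_zero (isUnit_iterate_twist 1 hw) x.1.2)
        rwa [one_mul, iterate_twist_unit_mul_pow] at this
  choose d' h1 h2 h3 using H
  exact ⟨d', h1, h2, h3⟩

end IsMinimalFamily

theorem isMinimalFamily_initialFamily (h : IsChainRing p r S) :
    IsMinimalFamily p (solutionModule u 0) (initialFamily S p r) fun _ => 0 where
  mem x := mem_solutionModule_iff.mpr fun j hj => absurd hj (Nat.not_lt_zero j)
  lead x := ⟨1, isUnit_one, by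
    rw [one_mul]
    exact hasLead_monomialPair (by simpa using h.unit_mul_pow_ne_zero isUnit_one x.1.2)⟩
  le x R _ n a _ _ := Nat.zero_le n

/-! ### Executions of the algorithm on sets -/

theorem exists_update (B : Set (Pair S)) (P : Pair S) : ∃ P', Update u k B P P' := by
  by_cases h0 : discrepancy u k P = 0
  · exact ⟨P, Or.inl ⟨h0, rfl⟩⟩
  by_cases hQ : ∃ Q ∈ B, lt Q < lt P ∧ discrepancy u k Q ∣ discrepancy u k P
  · obtain ⟨Q, hQB, hlt, q, hq⟩ := id hQ
    exact ⟨_, Or.inr (Or.inl ⟨h0, Q, hQB, hlt, q, by rw [hq, mul_comm], rfl⟩)⟩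
  · exact ⟨_, Or.inr (Or.inr ⟨h0, hQ, rfl⟩)⟩

theorem exists_step (u : SkewPolynomial S) (k : ℕ) (B : Set (Pair S)) : ∃ B', Step u k B B' := by
  choose τ hτ using exists_update (u := u) (k := k) B
  exact ⟨τ '' B, τ, fun P _ => hτ P, rfl⟩

theorem exists_isRun (p r : ℕ) (u : SkewPolynomial S) (m : ℕ) : ∃ B, IsRun p r u m B := by
  choose f hf using exists_step u
  exact ⟨fun k => Nat.rec (initialSet S p r) (fun k B => f k B) k, rfl, fun k _ => hf k _⟩

theorem IsRun.exists_isMinimalFamily (h : IsChainRing p r S) {m : ℕ} {B : ℕ → Set (Pair S)}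
    (hB : IsRun p r u m B) {k : ℕ} (hk : k ≤ m) :
    ∃ (F : Fin r × Fin 2 → Pair S) (d : Fin r × Fin 2 → ℕ),
      IsMinimalFamily p (solutionModule u k) F d ∧ Set.range F = B k := by
  induction k with
  | zero =>
    exact ⟨_, _, isMinimalFamily_initialFamily h, by rw [range_initialFamily, hB.1]⟩
  | succ k ih =>
    obtain ⟨F, d, hF, hr⟩ := ih (by omega)
    obtain ⟨τ, hτ, hB'⟩ := hB.2 k hk
    rw [← hr] at hτ hB'
    obtain ⟨d', hd'⟩ := hF.update h (F' := τ ∘ F) fun x => hτ _ (Set.mem_range_self x)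
    exact ⟨_, d', hd', by rw [hB', Set.range_comp]⟩

theorem IsRun.isLeftGroebnerBasis (h : IsChainRing p r S) {m : ℕ} {B : ℕ → Set (Pair S)}
    (hB : IsRun p r u m B) {k : ℕ} (hk : k ≤ m) :
    IsLeftGroebnerBasis (B k) (solutionModule u k) ∧ (B k).ncard = 2 * r := by
  obtain ⟨F, d, hF, hr⟩ := hB.exists_isMinimalFamily h hk
  rw [← hr]
  exact ⟨hF.isLeftGroebnerBasis h, hF.ncard_range h⟩

end SkewBF

/-! ### Programs: deterministic parts, loops, and operation counts -/

namespace SkewBF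

namespace Prog

variable {α β : Type*}

/-- The program that returns `a` after exactly `c` operations. -/
def det (a : α) (c : ℕ) : Prog α := fun b n => b = a ∧ n = c

theorem ret_eq_det (a : α) : ret a = det a 0 := rfl

theorem op_singleton (a : α) : op {a} = det a 1 := rfl

theorem det_bind_apply {a : α} {c : ℕ} {f : α → Prog β} {b : β} {n : ℕ} :
    (det a c).bind f b n ↔ ∃ c', f a b c' ∧ n = c + c' := by
  constructor
  · rintro ⟨_, _, c', ⟨rfl, rfl⟩, h, rfl⟩
    exact ⟨c', h, rfl⟩
  · rintro ⟨c', h, rfl⟩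
    exact ⟨a, c, c', ⟨rfl, rfl⟩, h, rfl⟩

theorem det_bind {x : Prog α} {a : α} {c : ℕ} {f : α → Prog β} {b : β} {c' n : ℕ}
    (hx : x = det a c) (hf : f a = det b c') (hn : n = c + c') : x.bind f = det b n := by
  subst hx hn
  funext v k
  rw [eq_iff_iff, det_bind_apply, hf]
  constructor
  · rintro ⟨_, ⟨rfl, rfl⟩, rfl⟩
    exact ⟨rfl, rfl⟩
  · rintro ⟨rfl, rfl⟩
    exact ⟨_, ⟨rfl, rfl⟩, rfl⟩

theorem exists_forEach_eq_det {f : α → Prog β} {g : α → β} {N : ℕ} {l : List α}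
    (hf : ∀ a ∈ l, ∃ c ≤ N, f a = det (g a) c) :
    ∃ c ≤ l.length * N, forEach f l = det (l.map g) c := by
  induction l with
  | nil => exact ⟨0, Nat.zero_le _, rfl⟩
  | cons a l ih =>
    rw [List.forall_mem_cons] at hf
    obtain ⟨⟨c, hc, ha⟩, hl⟩ := hf
    obtain ⟨c', hc', hl'⟩ := ih hl
    refine ⟨c + c', ?_, det_bind ha (det_bind hl' (ret_eq_det _) rfl) rfl⟩
    rw [List.length_cons, add_mul]
    omega

theorem forall₂_of_forEach {f : α → Prog β} {R : α → β → Prop} {N : ℕ} {l : List α} {L : List β}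
    {c : ℕ} (hf : ∀ a ∈ l, ∀ b n, f a b n → R a b ∧ n ≤ N) (h : forEach f l L c) :
    List.Forall₂ R l L ∧ c ≤ l.length * N := by
  induction l generalizing L c with
  | nil =>
    obtain ⟨rfl, rfl⟩ := h
    exact ⟨List.Forall₂.nil, by simp⟩
  | cons a l ih =>
    rw [List.forall_mem_cons] at hf
    obtain ⟨b, n, _, hb, ⟨L, n', _, hL, ⟨rfl, rfl⟩, rfl⟩, rfl⟩ := h
    obtain ⟨h1, h2⟩ := ih hf.2 hL
    obtain ⟨h3, h4⟩ := hf.1 b n hb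
    refine ⟨List.Forall₂.cons h3 h1, ?_⟩
    rw [List.length_cons, add_mul]
    omega

theorem exists_forEach {f : α → Prog β} {R : α → β → Prop} {l : List α}
    (h : ∀ a ∈ l, ∃ b n, f a b n ∧ R a b) :
    ∃ L c, forEach f l L c ∧ List.Forall₂ R l L := by
  induction l with
  | nil => exact ⟨[], 0, ⟨rfl, rfl⟩, List.Forall₂.nil⟩
  | cons a l ih =>
    rw [List.forall_mem_cons] at h
    obtain ⟨b, n, hb, hR⟩ := h.1
    obtain ⟨L, c, hL, hRL⟩ := ih h.2
    exact ⟨b :: L, n + (c + 0), ⟨b, n, _, hb, ⟨L, c, 0, hL, ⟨rfl, rfl⟩, rfl⟩, rfl⟩,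
      List.Forall₂.cons hR hRL⟩

end Prog

/-! ### Skew polynomials as coefficient lists -/

section Lists

variable {S : Type*} [CommRing S]

theorem coeff_toPoly (l : List S) (n : ℕ) : (toPoly l).coeff n = l.getD n 0 := by
  have h : ∀ s : Finset ℕ, (∑ i ∈ s, monomial i (l.getD i 0)).coeff n =
      if n ∈ s then l.getD n 0 else 0 := by
    intro s
    induction s using Finset.induction_on with
    | empty => simp
    | insert a s ha ih =>
      rw [Finset.sum_insert ha, SkewPolynomial.coeff_add, ih, coeff_monomial]
      by_cases han : a = n
      · subst han
        simp [ha]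
      · simp [han, Ne.symm han]
  rw [toPoly, h]
  split_ifs with hn
  · rfl
  · rw [List.getD_eq_default _ _ (not_lt.mp (mt Finset.mem_range.mpr hn))]

theorem dot_eq_det (as bs : List S) :
    dot as bs = Prog.det ((List.zipWith (· * ·) as bs).sum) (2 * min as.length bs.length) := by
  induction as generalizing bs with
  | nil => cases bs <;> rfl
  | cons a as ih =>
    cases bs with
    | nil => rfl
    | cons b bs =>
      exact Prog.det_bind (Prog.op_singleton _) (Prog.det_bind (ih bs) (Prog.op_singleton _) rfl)
        (by simp only [List.length_cons]; omega)

theorem sum_zipWith_eq (as bs : List S) :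
    (List.zipWith (· * ·) as bs).sum =
      ∑ j ∈ Finset.range bs.length, as.getD j 0 * bs.getD j 0 := by
  induction bs generalizing as with
  | nil => simp
  | cons b bs ih =>
    cases as with
    | nil => simp
    | cons a as =>
      rw [List.length_cons, Finset.sum_range_succ']
      simp [ih, add_comm]

theorem exists_subMul_eq_det (q : S) (as bs : List S) :
    ∃ l : List S, subMul q as bs = Prog.det l (2 * bs.length) ∧
      l.length = max as.length bs.length ∧
      ∀ n, l.getD n 0 = as.getD n 0 - q * bs.getD n 0 := by
  induction bs generalizing as with
  | nil =>
    refine ⟨as, ?_, by simp, by simp⟩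
    cases as <;> rfl
  | cons b bs ih =>
    cases as with
    | nil =>
      obtain ⟨l, h1, h2, h3⟩ := ih []
      refine ⟨(0 - q * b) :: l, ?_, by simpa using h2, fun n => ?_⟩
      · exact Prog.det_bind (Prog.op_singleton _) (Prog.det_bind (Prog.op_singleton _)
          (Prog.det_bind h1 (Prog.ret_eq_det _) rfl) rfl)
          (by simp only [List.length_cons]; omega)
      · cases n with
        | zero => simp
        | succ n => simpa using h3 n
    | cons a as =>
      obtain ⟨l, h1, h2, h3⟩ := ih as
      refine ⟨(a - q * b) :: l, ?_, by simp [h2], fun n => ?_⟩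
      · exact Prog.det_bind (Prog.op_singleton _) (Prog.det_bind (Prog.op_singleton _)
          (Prog.det_bind h1 (Prog.ret_eq_det _) rfl) rfl)
          (by simp only [List.length_cons]; omega)
      · cases n with
        | zero => simp
        | succ n => simpa using h3 n

/-- The computed degree `d` is characterized by the vanishing of the coefficients above it. -/
theorem exists_degree_eq_det (l : List S) :
    ∃ d c, degree l = Prog.det d c ∧ c ≤ l.length ∧
      ∀ n : ℕ, d < (n : WithBot ℕ) ↔ ∀ j, n ≤ j → l.getD j 0 = 0 := by
  induction l with
  | nil => exact ⟨⊥, 0, rfl, le_rfl, by simp⟩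
  | cons a l ih =>
    obtain ⟨d, c, h1, h2, h3⟩ := ih
    have hcons : ∀ n, (∀ j, n + 1 ≤ j → (a :: l).getD j 0 = 0) ↔
        ∀ j, n ≤ j → l.getD j 0 = 0 := by
      refine fun n => ⟨fun h j hj => by simpa using h (j + 1) (by omega), fun h j hj => ?_⟩
      obtain ⟨i, rfl⟩ := Nat.exists_eq_add_of_le' (Nat.one_le_of_lt hj)
      simpa using h i (by omega)
    induction d with
    | bot =>
      have h0 : ∀ j, l.getD j 0 = 0 := fun j =>
        (h3 0).mp (WithBot.bot_lt_coe _) j (Nat.zero_le j)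
      by_cases ha : a = 0
      · refine ⟨⊥, c + 1,
          Prog.det_bind h1 (Prog.det_bind (c' := 0) (Prog.op_singleton _) ?_ rfl) rfl,
          by simpa using h2, fun n => ?_⟩
        · simp [ha, Prog.ret_eq_det]
        · refine iff_of_true (WithBot.bot_lt_coe n) fun j _ => ?_
          cases j with
          | zero => simpa using ha
          | succ j => simpa using h0 j
      · refine ⟨((0 : ℕ) : WithBot ℕ), c + 1,
          Prog.det_bind h1 (Prog.det_bind (c' := 0) (Prog.op_singleton _) ?_ rfl) rfl,
          by simpa using h2, fun n => ?_⟩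
        · simp [ha, Prog.ret_eq_det]
        · cases n with
          | zero =>
            refine iff_of_false (lt_irrefl _) fun h => ha ?_
            simpa using h 0 le_rfl
          | succ n =>
            rw [hcons]
            exact iff_of_true (WithBot.coe_lt_coe.mpr (Nat.succ_pos n)) fun j _ => h0 j
    | coe d =>
      refine ⟨((d + 1 : ℕ) : WithBot ℕ), c, Prog.det_bind h1 (Prog.ret_eq_det _) rfl,
        h2.trans (Nat.le_succ _), fun n => ?_⟩
      cases n with
      | zero =>
        refine iff_of_false (by simp) fun h => ?_
        exact lt_irrefl _ ((h3 d).mpr ((hcons d).mp fun j _ => h j (Nat.zero_le j)))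
      | succ n =>
        rw [hcons, ← h3]
        simp only [WithBot.coe_lt_coe, Nat.cast_withBot]
        omega

theorem coeffAt_toPair (P : List S × List S) (n : ℕ) (c : Fin 2) :
    coeffAt (toPair P) (toLex (n, c)) = if c = 0 then P.1.getD n 0 else P.2.getD n 0 := by
  fin_cases c <;> simp [coeffAt, toPair, coeff_toPoly]

theorem map_toLex_zero_lt_zero (d : WithBot ℕ) (n : ℕ) :
    d.map (fun n => (toLex (n, (0 : Fin 2)) : Term)) < ((toLex (n, 0) : Term) : WithBot Term) ↔
      d < (n : WithBot ℕ) := by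
  induction d <;> simp [Prod.Lex.toLex_lt_toLex, Nat.cast_withBot]

theorem map_toLex_zero_lt_one (d : WithBot ℕ) (n : ℕ) :
    d.map (fun n => (toLex (n, (0 : Fin 2)) : Term)) < ((toLex (n, 1) : Term) : WithBot Term) ↔
      d < ((n + 1 : ℕ) : WithBot ℕ) := by
  induction d with
  | bot => simp
  | coe d =>
    rw [WithBot.map_coe, WithBot.coe_lt_coe, Nat.cast_withBot, WithBot.coe_lt_coe,
      Prod.Lex.toLex_lt_toLex]
    simp [← le_iff_lt_or_eq]

theorem map_toLex_one_lt (d : WithBot ℕ) (n : ℕ) (c : Fin 2) :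
    d.map (fun n => (toLex (n, (1 : Fin 2)) : Term)) < ((toLex (n, c) : Term) : WithBot Term) ↔
      d < (n : WithBot ℕ) := by
  induction d with
  | bot => simp
  | coe d =>
    have : ¬ (1 : Fin 2) < c := by omega
    simp [Prod.Lex.toLex_lt_toLex, Nat.cast_withBot, this]

theorem exists_leadingTerm_eq_det (P : List S × List S) :
    ∃ c ≤ P.1.length + P.2.length, leadingTerm P = Prog.det (lt (toPair P)) c := by
  obtain ⟨d, c, h1, h2, h3⟩ := exists_degree_eq_det P.1
  obtain ⟨d', c', h1', h2', h3'⟩ := exists_degree_eq_det P.2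
  refine ⟨c + c', add_le_add h2 h2', ?_⟩
  rw [← eq_lt_of_forall (P := toPair P)
    (d := max (d.map fun n => (toLex (n, (0 : Fin 2)) : Term))
      (d'.map fun n => (toLex (n, (1 : Fin 2)) : Term)))]
  · exact Prog.det_bind h1 (Prog.det_bind h1' (Prog.ret_eq_det _) rfl) rfl
  intro e
  have hsplit : (∀ e', e ≤ e' → coeffAt (toPair P) e' = 0) ↔
      (∀ n, e ≤ toLex (n, 0) → P.1.getD n 0 = 0) ∧ (∀ n, e ≤ toLex (n, 1) → P.2.getD n 0 = 0) := by
    refine ⟨fun h => ⟨fun n hn => ?_, fun n hn => ?_⟩, fun h e' => ?_⟩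
    · simpa [coeffAt_toPair] using h _ hn
    · simpa [coeffAt_toPair] using h _ hn
    · induction e' using Term.cases with
      | h0 n => simpa [coeffAt_toPair] using h.1 n
      | h1 n => simpa [coeffAt_toPair] using h.2 n
  rw [hsplit, max_lt_iff]
  induction e using Term.cases with
  | h0 n =>
    rw [map_toLex_zero_lt_zero, map_toLex_one_lt, h3, h3']
    simp [Prod.Lex.toLex_le_toLex, ← le_iff_lt_or_eq]
  | h1 n =>
    rw [map_toLex_zero_lt_one, map_toLex_one_lt, h3, h3']
    simp [Prod.Lex.toLex_le_toLex, ← le_iff_lt_or_eq]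

theorem powers_eq_det (p n : ℕ) (a : S) :
    powers p n a = Prog.det ((List.range n).map fun i => a * (p : S) ^ i) n := by
  induction n generalizing a with
  | zero => rfl
  | succ n ih =>
    have hl : (List.range (n + 1)).map (fun i => a * (p : S) ^ i) =
        a :: (List.range n).map fun i => a * (p : S) * (p : S) ^ i := by
      rw [List.range_succ_eq_map, List.map_cons, List.map_map, pow_zero, mul_one]
      congr 1
      refine List.map_congr_left fun i _ => ?_
      simp only [Function.comp_apply, Nat.succ_eq_add_one, pow_succ']
      ring
    rw [hl]
    exact Prog.det_bind (Prog.op_singleton _)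
      (Prog.det_bind (ih _) (Prog.ret_eq_det _) rfl) (by omega)

variable [MulSemiringAction (Multiplicative ℕ) S]

theorem exists_forEach_opTwist_eq_det (l : List S) :
    ∃ c ≤ l.length, Prog.forEach opTwist l = Prog.det (l.map (φ : S →+* S)) c := by
  simpa using Prog.exists_forEach_eq_det (N := 1) (l := l) (f := opTwist) (g := (φ : S →+* S))
    fun a _ => ⟨1, le_rfl, Prog.op_singleton _⟩

theorem exists_shift_eq_det (l : List S) :
    ∃ c ≤ l.length, shift l = Prog.det (0 :: l.map (φ : S →+* S)) c := by
  obtain ⟨c, hc, h⟩ := exists_forEach_opTwist_eq_det l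
  exact ⟨c, hc, Prog.det_bind h (Prog.ret_eq_det _) rfl⟩

theorem toPoly_shift (l : List S) :
    toPoly (0 :: l.map (φ : S →+* S)) = (X : SkewPolynomial S) * toPoly l := by
  ext n
  rw [coeff_toPoly]
  cases n with
  | zero => exact (coeff_monomial_mul_of_lt one_pos 1 (toPoly l)).symm
  | succ n =>
    have := coeff_monomial_mul_add 1 n 1 (toPoly l)
    rw [monomial_one_one_eq_X, coeff_toPoly] at this
    rw [this, List.getD_cons_succ, one_mul, Function.iterate_one, List.getD_eq_getElem?_getD,
      List.getD_eq_getElem?_getD, List.getElem?_map]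
    cases l[n]? <;> simp

theorem toPoly_subMul {q : S} {as bs l : List S}
    (h : ∀ n, l.getD n 0 = as.getD n 0 - q * bs.getD n 0) :
    toPoly l = toPoly as - (C q : SkewPolynomial S) * toPoly bs := by
  ext n
  have := coeff_monomial_mul_add 0 n q (toPoly bs)
  rw [monomial_zero_left, Nat.add_zero, Function.iterate_zero, id] at this
  rw [SkewPolynomial.coeff_sub, this, coeff_toPoly, coeff_toPoly, coeff_toPoly, h]

end Lists

end SkewBF

/-! ### The program and the algorithm -/

namespace SkewBF

section StoredSets

variable {S : Type*} [CommRing S] {p r : ℕ}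

/-- The set of pairs stored in a list. -/
def storedSet (L : List (List S × List S)) : Set (Pair S) := {P | ∃ Q ∈ L, P = toPair Q}

theorem storedSet_eq_range (L : List (List S × List S)) :
    storedSet L = Set.range fun i : Fin L.length => toPair (L.get i) := by
  ext P
  simp only [storedSet, Set.mem_range]
  constructor
  · rintro ⟨Q, hQ, rfl⟩
    obtain ⟨i, rfl⟩ := List.get_of_mem hQ
    exact ⟨i, rfl⟩
  · rintro ⟨i, rfl⟩
    exact ⟨_, List.get_mem L i, rfl⟩

/-- The stored initial pairs. -/
def initialList (S : Type*) [CommRing S] (p r : ℕ) : List (List S × List S) :=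
  ((List.range r).map fun i => ([(p : S) ^ i], [])) ++
    (List.range r).map fun i => ([], [(p : S) ^ i])

theorem toPair_initial (a : S) : toPair ([a], []) = (C a, 0) ∧ toPair ([], [a]) = (0, C a) := by
  simp [toPair, toPoly]

theorem storedSet_initialList : storedSet (initialList S p r) = initialSet S p r := by
  ext P
  simp only [storedSet, initialList, initialSet, Set.mem_union, List.mem_append, List.mem_map,
    List.mem_range]
  constructor
  · rintro ⟨Q, ⟨i, hi, rfl⟩ | ⟨i, hi, rfl⟩, rfl⟩
    · exact Or.inl ⟨i, hi, (toPair_initial _).1⟩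
    · exact Or.inr ⟨i, hi, (toPair_initial _).2⟩
  · rintro (⟨i, hi, rfl⟩ | ⟨i, hi, rfl⟩)
    · exact ⟨_, Or.inl ⟨i, hi, rfl⟩, (toPair_initial _).1.symm⟩
    · exact ⟨_, Or.inr ⟨i, hi, rfl⟩, (toPair_initial _).2.symm⟩

end StoredSets

variable {S : Type*} [CommRing S] [MulSemiringAction (Multiplicative ℕ) S] {p r : ℕ}
  {u : SkewPolynomial S} {k : ℕ}

/-- The elements `σ^j(u_{k-j})`, `0 ≤ j ≤ k`. -/
noncomputable def twistedCoeffs (u : SkewPolynomial S) (k : ℕ) : List S :=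
  (List.range (k + 1)).map fun j => (φ : S →+* S)^[j] (u.coeff (k - j))

theorem length_twistedCoeffs : (twistedCoeffs u k).length = k + 1 := by
  simp [twistedCoeffs]

theorem twistedCoeffs_succ :
    twistedCoeffs u (k + 1) = u.coeff (k + 1) :: (twistedCoeffs u k).map (φ : S →+* S) := by
  rw [twistedCoeffs, List.range_succ_eq_map, List.map_cons, List.map_map, twistedCoeffs,
    List.map_map]
  congr 1
  refine List.map_congr_left fun j _ => ?_
  simp only [Function.comp_apply, Nat.succ_eq_add_one, Function.iterate_succ_apply',
    Nat.add_sub_add_right]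

theorem sum_zipWith_twistedCoeffs (l : List S) :
    (List.zipWith (· * ·) l (twistedCoeffs u k)).sum = (toPoly l * u).coeff k := by
  rw [sum_zipWith_eq, length_twistedCoeffs, coeff_skew_mul]
  refine Finset.sum_congr rfl fun j hj => ?_
  rw [coeff_toPoly, List.getD_eq_getElem?_getD (l := twistedCoeffs u k), twistedCoeffs,
    List.getElem?_map, List.getElem?_range (Finset.mem_range.mp hj)]
  rfl

/-- The data of a stored pair in step `k`. -/
noncomputable def entryOf (p r : ℕ) (u : SkewPolynomial S) (k : ℕ) (P : List S × List S) :
    Entry S :=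
  ⟨P, discrepancy u k (toPair P), valuation p r (discrepancy u k (toPair P)), lt (toPair P)⟩

theorem exists_examine_eq_det {N : ℕ} {P : List S × List S} (h1 : P.1.length ≤ N)
    (h2 : P.2.length ≤ N) :
    ∃ c ≤ 4 * N + 2, examine p r k (twistedCoeffs u k) P = Prog.det (entryOf p r u k P) c := by
  obtain ⟨c, hc, hl⟩ := exists_leadingTerm_eq_det P
  refine ⟨2 * min P.1.length (twistedCoeffs u k).length + (1 + (1 + c)), by omega, ?_⟩
  have hd : (List.zipWith (· * ·) P.1 (twistedCoeffs u k)).sum - P.2.getD k 0 =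
      discrepancy u k (toPair P) := by
    rw [sum_zipWith_twistedCoeffs, ← coeff_toPoly, discrepancy, SkewPolynomial.coeff_sub]
    rfl
  rw [entryOf, ← hd]
  exact Prog.det_bind (dot_eq_det _ _) (Prog.det_bind (Prog.op_singleton _)
    (Prog.det_bind (Prog.op_singleton _) (Prog.det_bind hl (Prog.ret_eq_det _) rfl) rfl) rfl) rfl

theorem toPair_shift (P : List S × List S) :
    toPair (0 :: P.1.map (φ : S →+* S), 0 :: P.2.map (φ : S →+* S)) =
      (X : SkewPolynomial S) • toPair P :=
  Prod.ext (toPoly_shift P.1) (toPoly_shift P.2)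

/-- The test of the program on leading terms and valuations is that of the algorithm. -/
theorem exists_entry_iff (h : IsChainRing p r S) (L : List (List S × List S))
    (P : List S × List S) :
    (∃ Q ∈ L.map (entryOf p r u k), Q.lead < (entryOf p r u k P).lead ∧
      Q.val ≤ (entryOf p r u k P).val) ↔
    ∃ Q ∈ storedSet L, lt Q < lt (toPair P) ∧
      discrepancy u k Q ∣ discrepancy u k (toPair P) := by
  constructor
  · rintro ⟨_, hQ, h1, h2⟩
    obtain ⟨Q, hQL, rfl⟩ := List.mem_map.mp hQ
    exact ⟨toPair Q, ⟨Q, hQL, rfl⟩, h1, h.dvd_iff.mpr h2⟩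
  · rintro ⟨_, ⟨Q, hQ, rfl⟩, h1, h2⟩
    exact ⟨entryOf p r u k Q, List.mem_map_of_mem hQ, h1, h.dvd_iff.mp h2⟩

section InnerLoop

variable {E : List (Entry S)} {R : Entry S} {P' : List S × List S} {c : ℕ}

theorem process_of_disc_eq_zero (h0 : R.disc = 0) :
    process E R = Prog.det R.pair 1 := by
  refine Prog.det_bind (Prog.op_singleton _) (c' := 0) ?_ rfl
  simp [h0, Prog.ret_eq_det]

theorem process_of_exists (h0 : R.disc ≠ 0)
    (hE : ∃ Q ∈ E, Q.lead < R.lead ∧ Q.val ≤ R.val) :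
    process E R P' c ↔ ∃ Q ∈ E, Q.lead < R.lead ∧ Q.val ≤ R.val ∧
      ∃ q, (Q.disc ∣ R.disc → R.disc = q * Q.disc) ∧
        ∃ c₁, subMul q R.pair.1 Q.pair.1 P'.1 c₁ ∧
        ∃ c₂, subMul q R.pair.2 Q.pair.2 P'.2 c₂ ∧ c = c₁ + c₂ + 2 := by
  have hz : process E R P' c ↔ ∃ c', ((Prog.anyOf {Q | Q ∈ E ∧ Q.lead < R.lead ∧
      Q.val ≤ R.val}).bind fun Q =>
        (opQuo R.disc Q.disc).bind fun q => (subMul q R.pair.1 Q.pair.1).bind fun f =>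
          (subMul q R.pair.2 Q.pair.2).bind fun g => Prog.ret (f, g)) P' c' ∧ c = 1 + c' := by
    refine Prog.det_bind_apply.trans ?_
    rw [if_neg (by simpa using h0), if_pos hE]
  rw [hz]
  constructor
  · rintro ⟨_, ⟨Q, _, _, ⟨⟨hQ, h1, h2⟩, rfl⟩, ⟨q, _, _, ⟨hq, rfl⟩, ⟨f, c₁, _, hf, ⟨g, c₂, _, hg,
      ⟨rfl, rfl⟩, rfl⟩, rfl⟩, rfl⟩, rfl⟩, rfl⟩
    exact ⟨Q, hQ, h1, h2, q, hq, c₁, hf, _, hg, by omega⟩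
  · rintro ⟨Q, hQ, h1, h2, q, hq, c₁, hf, c₂, hg, rfl⟩
    exact ⟨0 + (1 + (c₁ + (c₂ + 0))), ⟨Q, 0, _, ⟨⟨hQ, h1, h2⟩, rfl⟩, ⟨q, 1, _, ⟨hq, rfl⟩,
      ⟨P'.1, c₁, _, hf, ⟨P'.2, c₂, 0, hg, ⟨rfl, rfl⟩, rfl⟩, rfl⟩, rfl⟩, rfl⟩, by omega⟩

theorem exists_process_eq_det_of_not_exists (h0 : R.disc ≠ 0)
    (hE : ¬ ∃ Q ∈ E, Q.lead < R.lead ∧ Q.val ≤ R.val) :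
    ∃ c ≤ R.pair.1.length + R.pair.2.length + 1, process E R =
      Prog.det (0 :: R.pair.1.map (φ : S →+* S), 0 :: R.pair.2.map (φ : S →+* S)) c := by
  obtain ⟨c₁, hc₁, h1⟩ := exists_shift_eq_det R.pair.1
  obtain ⟨c₂, hc₂, h2⟩ := exists_shift_eq_det R.pair.2
  refine ⟨1 + (c₁ + c₂), by omega, Prog.det_bind (Prog.op_singleton _) (c' := c₁ + c₂) ?_ rfl⟩
  rw [if_neg (by simpa using h0), if_neg hE]
  exact Prog.det_bind h1 (Prog.det_bind h2 (Prog.ret_eq_det _) rfl) rfl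

end InnerLoop

theorem toPair_subMul {q : S} {P Q P' : List S × List S} {c₁ c₂ : ℕ}
    (h1 : subMul q P.1 Q.1 P'.1 c₁) (h2 : subMul q P.2 Q.2 P'.2 c₂) :
    toPair P' = toPair P - (C q : SkewPolynomial S) • toPair Q ∧
      P'.1.length = max P.1.length Q.1.length ∧ P'.2.length = max P.2.length Q.2.length ∧
      c₁ = 2 * Q.1.length ∧ c₂ = 2 * Q.2.length := by
  obtain ⟨l, hl, hlen, hget⟩ := exists_subMul_eq_det q P.1 Q.1
  obtain ⟨l', hl', hlen', hget'⟩ := exists_subMul_eq_det q P.2 Q.2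
  rw [hl] at h1
  rw [hl'] at h2
  obtain ⟨h1, rfl⟩ := h1
  obtain ⟨h2, rfl⟩ := h2
  rw [← h1] at hlen hget
  rw [← h2] at hlen' hget'
  exact ⟨Prod.ext (toPoly_subMul hget) (toPoly_subMul hget'), hlen, hlen', rfl, rfl⟩

theorem update_of_process (h : IsChainRing p r S) {L : List (List S × List S)} {N : ℕ}
    (hN : ∀ Q ∈ L, Q.1.length ≤ N ∧ Q.2.length ≤ N) {P P' : List S × List S} (hP : P ∈ L) {c : ℕ}
    (hc : process (L.map (entryOf p r u k)) (entryOf p r u k P) P' c) :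
    Update u k (storedSet L) (toPair P) (toPair P') ∧
      (P'.1.length ≤ N + 1 ∧ P'.2.length ≤ N + 1) ∧ c ≤ 4 * N + 2 := by
  have hPN := hN P hP
  by_cases h0 : (entryOf p r u k P).disc = 0
  · rw [process_of_disc_eq_zero h0] at hc
    obtain ⟨hPP', rfl⟩ := hc
    change P' = P at hPP'
    rw [hPP']
    exact ⟨Or.inl ⟨h0, rfl⟩, by omega, by omega⟩
  by_cases hE : ∃ Q ∈ L.map (entryOf p r u k), Q.lead < (entryOf p r u k P).lead ∧
      Q.val ≤ (entryOf p r u k P).val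
  · rw [process_of_exists h0 hE] at hc
    obtain ⟨_, hQ, h1, h2, q, hq, c₁, hc₁, c₂, hc₂, rfl⟩ := hc
    obtain ⟨Q, hQL, rfl⟩ := List.mem_map.mp hQ
    obtain ⟨h3, h4, h5, rfl, rfl⟩ := toPair_subMul (P := P) (Q := Q) hc₁ hc₂
    have hQN := hN Q hQL
    exact ⟨Or.inr (Or.inl ⟨h0, toPair Q, ⟨Q, hQL, rfl⟩, h1, q, hq (h.dvd_iff.mpr h2), h3⟩),
      by omega, by omega⟩
  · obtain ⟨c', hc', h1⟩ := exists_process_eq_det_of_not_exists h0 hE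
    rw [h1] at hc
    obtain ⟨rfl, rfl⟩ := hc
    change c ≤ P.1.length + P.2.length + 1 at hc'
    refine ⟨Or.inr (Or.inr ⟨h0, (exists_entry_iff h L P).not.mp hE, toPair_shift P⟩), ?_, by omega⟩
    simpa [entryOf] using hPN

theorem exists_process_of_update (h : IsChainRing p r S) {L : List (List S × List S)}
    {P : List S × List S} {T : Pair S} (hT : Update u k (storedSet L) (toPair P) T) :
    ∃ P' c, process (L.map (entryOf p r u k)) (entryOf p r u k P) P' c ∧ T = toPair P' := by
  rcases hT with ⟨h0, rfl⟩ | ⟨h0, _, ⟨Q, hQ, rfl⟩, hlt, q, hq, rfl⟩ | ⟨h0, hno, rfl⟩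
  · refine ⟨P, 1, ?_, rfl⟩
    rw [process_of_disc_eq_zero h0]
    exact ⟨rfl, rfl⟩
  · obtain ⟨l, hl, -, -⟩ := exists_subMul_eq_det q P.1 Q.1
    obtain ⟨l', hl', -, -⟩ := exists_subMul_eq_det q P.2 Q.2
    have hl : subMul q P.1 Q.1 l (2 * Q.1.length) := by
      rw [hl]
      exact ⟨rfl, rfl⟩
    have hl' : subMul q P.2 Q.2 l' (2 * Q.2.length) := by
      rw [hl']
      exact ⟨rfl, rfl⟩
    have hd : discrepancy u k (toPair Q) ∣ discrepancy u k (toPair P) := by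
      rw [hq]
      exact dvd_mul_left _ _
    refine ⟨(l, l'), _, (process_of_exists h0 ((exists_entry_iff h L P).mpr
      ⟨toPair Q, ⟨Q, hQ, rfl⟩, hlt, hd⟩)).mpr ⟨entryOf p r u k Q, List.mem_map_of_mem hQ, hlt,
        h.dvd_iff.mp hd, q, fun _ => hq, _, hl, _, hl', rfl⟩,
      (toPair_subMul (P' := (l, l')) hl hl').1.symm⟩
  · obtain ⟨c, -, h1⟩ := exists_process_eq_det_of_not_exists (E := L.map (entryOf p r u k))
      (R := entryOf p r u k P) h0 ((exists_entry_iff h L P).not.mpr hno)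
    refine ⟨_, c, ?_, (toPair_shift P).symm⟩
    rw [h1]
    exact ⟨rfl, rfl⟩

/-! ### Executions of the program -/

theorem stateBefore_zero :
    stateBefore p r u 0 = Prog.det (twistedCoeffs u 0, initialList S p r) r := by
  refine Prog.det_bind (powers_eq_det p r 1) (c' := 0) ?_ rfl
  simp [Prog.ret_eq_det, twistedCoeffs, initialList, Function.comp_def]

/-- One round of the program on the stored pairs `L`: only the updates of the pairs involve choices,
the other parts have the fixed costs `c₁` and `c₂`. -/
theorem exists_stateBefore_succ_iff {L : List (List S × List S)}
    {N : ℕ} (hN : ∀ Q ∈ L, Q.1.length ≤ N ∧ Q.2.length ≤ N) :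
    ∃ c₁ ≤ L.length * (4 * N + 2), ∃ c₂ ≤ k + 1, ∀ s c,
      ((Prog.forEach (examine p r k (twistedCoeffs u k)) L).bind fun E =>
        (Prog.forEach (process E) E).bind fun L' =>
          (Prog.forEach opTwist (twistedCoeffs u k)).bind fun T =>
            Prog.ret (u.coeff (k + 1) :: T, L')) s c ↔
      s.1 = twistedCoeffs u (k + 1) ∧
        ∃ c', Prog.forEach (process (L.map (entryOf p r u k))) (L.map (entryOf p r u k)) s.2 c' ∧
          c = c₁ + (c' + c₂) := by
  obtain ⟨c₁, hc₁, h1⟩ := Prog.exists_forEach_eq_det (l := L)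
    (f := examine p r k (twistedCoeffs u k)) (g := entryOf p r u k) (N := 4 * N + 2)
    fun P hP => exists_examine_eq_det (hN P hP).1 (hN P hP).2
  obtain ⟨c₂, hc₂, h2⟩ := exists_forEach_opTwist_eq_det (twistedCoeffs u k)
  rw [length_twistedCoeffs] at hc₂
  refine ⟨c₁, hc₁, c₂, hc₂, fun s c => ?_⟩
  rw [h1, Prog.det_bind_apply, h2]
  constructor
  · rintro ⟨_, ⟨L', c', _, hL', ⟨T, _, _, ⟨rfl, rfl⟩, ⟨rfl, rfl⟩, rfl⟩, rfl⟩, rfl⟩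
    exact ⟨twistedCoeffs_succ.symm, c', hL', by omega⟩
  · rintro ⟨hs, c', hL', rfl⟩
    refine ⟨c' + (c₂ + 0), ⟨s.2, c', _, hL', ⟨_, c₂, 0, ⟨rfl, rfl⟩, ⟨?_, rfl⟩, rfl⟩, rfl⟩, rfl⟩
    rw [← twistedCoeffs_succ, ← hs]

/-- Pairwise distinct stored pairs can be updated independently of each other, by one map on
pairs. -/
theorem step_of_forall₂ {L L' : List (List S × List S)} (hcard : (storedSet L).ncard = L.length)
    (hL : List.Forall₂ (fun P P' => Update u k (storedSet L) (toPair P) (toPair P')) L L') :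
    Step u k (storedSet L) (storedSet L') := by
  set f : Fin L.length → Pair S := fun i => toPair (L.get i) with hf
  have hinj : Function.Injective f := by
    rw [storedSet_eq_range, ← Set.image_univ] at hcard
    have : Set.InjOn f Set.univ := by
      refine Set.injOn_of_ncard_image_eq ?_
      rw [hcard, Set.ncard_univ]
      simp
    exact Set.injOn_univ.mp this
  have hlen := hL.length_eq
  refine ⟨Function.extend f (fun i => toPair (L'.get (i.cast hlen))) id, ?_, ?_⟩
  · rintro _ ⟨Q, hQ, rfl⟩
    obtain ⟨i, rfl⟩ := List.get_of_mem hQ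
    rw [show toPair (L.get i) = f i from rfl, hinj.extend_apply]
    exact hL.get i.2 (hlen ▸ i.2)
  · rw [storedSet_eq_range L, ← Set.range_comp, Function.extend_comp hinj, storedSet_eq_range L']
    exact ((finCongr hlen).surjective.range_comp fun i => toPair (L'.get i)).symm

theorem IsRun.extend {B : ℕ → Set (Pair S)} (hB : IsRun p r u k B) {B' : Set (Pair S)}
    (h : Step u k (B k) B') : IsRun p r u (k + 1) (Function.update B (k + 1) B') := by
  refine ⟨by rw [Function.update_of_ne (by omega), hB.1], fun j hj => ?_⟩
  rw [Function.update_of_ne (by omega)]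
  rcases Nat.lt_succ_iff_lt_or_eq.mp hj with hj | rfl
  · rw [Function.update_of_ne (by omega)]
    exact hB.2 j hj
  · rwa [Function.update_self]

/-- Every execution of the program is an execution of the algorithm. Before step `k` the lists
have length at most `k + 1`, so that step `k` costs at most `25 r (k + 1)` operations. -/
theorem exists_isRun_of_stateBefore (h : IsChainRing p r S) {s : List S × List (List S × List S)}
    {c : ℕ} (hs : stateBefore p r u k s c) :
    s.1 = twistedCoeffs u k ∧ s.2.length = 2 * r ∧
      (∀ Q ∈ s.2, Q.1.length ≤ k + 1 ∧ Q.2.length ≤ k + 1) ∧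
      (∃ B, IsRun p r u k B ∧ B k = storedSet s.2) ∧ c ≤ r + 25 * r * k ^ 2 := by
  induction k generalizing s c with
  | zero =>
    rw [stateBefore_zero] at hs
    obtain ⟨rfl, rfl⟩ := hs
    refine ⟨rfl, by simp [initialList, two_mul], fun Q hQ => ?_,
      ⟨fun _ => initialSet S p c, ⟨rfl, fun k hk => absurd hk (Nat.not_lt_zero k)⟩,
        storedSet_initialList.symm⟩, by simp⟩
    simp only [initialList, List.mem_append, List.mem_map] at hQ
    rcases hQ with ⟨i, -, rfl⟩ | ⟨i, -, rfl⟩ <;> simp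
  | succ k ih =>
    obtain ⟨⟨T, L⟩, c₀, _, hs₀, hs, rfl⟩ := hs
    obtain ⟨hT, hlen, hN, ⟨B, hB, hBL⟩, hc₀⟩ := ih hs₀
    dsimp only at hT hlen hN hBL hs
    subst hT
    obtain ⟨c₁, hc₁, c₂, hc₂, hiff⟩ := exists_stateBefore_succ_iff (p := p) (r := r) (u := u)
      (k := k) hN
    obtain ⟨h1, c', h2, rfl⟩ := (hiff _ _).mp hs
    have hupd : ∀ R ∈ L.map (entryOf p r u k), ∀ P' n,
        process (L.map (entryOf p r u k)) R P' n →
        (Update u k (storedSet L) (toPair R.pair) (toPair P') ∧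
          (P'.1.length ≤ k + 1 + 1 ∧ P'.2.length ≤ k + 1 + 1)) ∧ n ≤ 4 * (k + 1) + 2 := by
      intro R hR P' n hn
      obtain ⟨P, hP, rfl⟩ := List.mem_map.mp hR
      exact and_assoc.mpr (update_of_process h hN hP hn)
    obtain ⟨h3, h4⟩ := Prog.forall₂_of_forEach hupd h2
    rw [List.length_map, hlen] at h4
    rw [hlen] at hc₁
    rw [List.forall₂_map_left_iff] at h3
    have hcard : (storedSet L).ncard = L.length := by
      rw [← hBL, (hB.isLeftGroebnerBasis h le_rfl).2, hlen]
    have hstep := step_of_forall₂ hcard (h3.imp fun _ _ hPP' => hPP'.1)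
    refine ⟨h1, by rw [← h3.length_eq, hlen], fun Q hQ => ?_,
      ⟨_, hB.extend (by rw [hBL]; exact hstep), Function.update_self ..⟩, ?_⟩
    · obtain ⟨i, rfl⟩ := List.get_of_mem hQ
      exact (h3.get (by rw [h3.length_eq]; exact i.2) i.2).2
    -- per pair `4 (k + 1) + 2` operations each for examining and for updating it, and `k + 1` for
    -- the list of twisted coefficients; in total at most `24 r (k + 1) + r (k + 1)`
    · have hr := h.pos
      nlinarith

/-- Every execution of the algorithm is carried out by some execution of the program. -/
theorem exists_stateBefore_of_isRun (h : IsChainRing p r S) {m : ℕ} {B : ℕ → Set (Pair S)}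
    (hB : IsRun p r u m B) (hk : k ≤ m) :
    ∃ s c, stateBefore p r u k s c ∧ storedSet s.2 = B k := by
  induction k with
  | zero =>
    refine ⟨(twistedCoeffs u 0, initialList S p r), r, ?_, by rw [storedSet_initialList, hB.1]⟩
    rw [stateBefore_zero]
    exact ⟨rfl, rfl⟩
  | succ k ih =>
    obtain ⟨⟨T, L⟩, c₀, hs₀, hBL⟩ := ih (by omega)
    obtain ⟨hT, -, hN, -, -⟩ := exists_isRun_of_stateBefore h hs₀
    dsimp only at hT hN hBL
    subst hT
    obtain ⟨c₁, -, c₂, -, hiff⟩ := exists_stateBefore_succ_iff (p := p) (r := r) (u := u)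
      (k := k) hN
    obtain ⟨τ, hτ, hB'⟩ := hB.2 k hk
    rw [← hBL] at hτ hB'
    obtain ⟨L', c', hL', hf⟩ := Prog.exists_forEach (l := L.map (entryOf p r u k))
      (f := process (L.map (entryOf p r u k)))
      (R := fun R P' => τ (toPair R.pair) = toPair P') (by
        intro R hR
        obtain ⟨P, hP, rfl⟩ := List.mem_map.mp hR
        exact exists_process_of_update h (hτ _ ⟨P, hP, rfl⟩))
    rw [List.forall₂_map_left_iff] at hf
    refine ⟨(twistedCoeffs u (k + 1), L'), _, ⟨(twistedCoeffs u k, L), c₀, _, hs₀,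
      (hiff _ _).mpr ⟨rfl, c', hL', rfl⟩, rfl⟩, ?_⟩
    have hmap : L.map (τ ∘ toPair) = L'.map toPair := by
      rw [← List.forall₂_eq_eq_eq, List.forall₂_map_left_iff, List.forall₂_map_right_iff]
      exact hf
    have hmem : ∀ P, P ∈ L.map (τ ∘ toPair) ↔ P ∈ L'.map toPair := fun P => by rw [hmap]
    rw [hB']
    ext P
    simp only [List.mem_map, Function.comp_apply] at hmem
    simp only [storedSet, Set.mem_image]
    constructor
    · rintro ⟨Q, hQ, rfl⟩
      obtain ⟨R, hR, hRQ⟩ := (hmem _).mpr ⟨Q, hQ, rfl⟩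
      exact ⟨toPair R, ⟨R, hR, rfl⟩, hRQ⟩
    · rintro ⟨_, ⟨R, hR, rfl⟩, rfl⟩
      obtain ⟨Q, hQ, hRQ⟩ := (hmem _).mp ⟨R, hR, rfl⟩
      exact ⟨Q, hQ, hRQ.symm⟩

end SkewBF

theorem mainTheorem2 :
    ∃ K : ℕ, ∀ (p r t : ℕ) [Fact p.Prime] (S : Type*) [CommRing S],
      SkewBF.IsGaloisRing p r t S → ∀ (σ : S ≃+* S),
      letI : MulSemiringAction (Multiplicative ℕ) S := SkewBF.powAction σ
      ∀ (u : SkewPolynomial S) (m : ℕ), 0 < m →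
        -- the algorithm, on sets of pairs, can be executed, and after every step it holds a
        -- left Gröbner basis with `2 r` elements, whichever choices are made
        (∃ B, SkewBF.IsRun p r u m B) ∧
        (∀ B, SkewBF.IsRun p r u m B →
          (∀ k < m,
            SkewBF.IsLeftGroebnerBasis (B (k + 1)) (SkewBF.solutionModule u (k + 1)) ∧
            (B (k + 1)).ncard = 2 * r) ∧
          SkewBF.IsLeftGroebnerBasis (B m) (SkewBF.solutionModule u m) ∧
          (B m).ncard = 2 * r) ∧
        -- the program has exactly the outputs of the algorithm and uses at most `K r m²`
        -- operations in `S`, whichever choices are made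
        (∀ B, SkewBF.IsRun p r u m B → ∃ L c, SkewBF.skewByrneFitzpatrick p r u m L c ∧
          {P | ∃ Q ∈ L, P = SkewBF.toPair Q} = B m) ∧
        (∀ L c, SkewBF.skewByrneFitzpatrick p r u m L c →
          (∃ B, SkewBF.IsRun p r u m B ∧ B m = {P | ∃ Q ∈ L, P = SkewBF.toPair Q}) ∧
          L.length = 2 * r ∧ c ≤ K * r * m ^ 2) := by
  -- `25 r m²` operations for the steps, and `r ≤ r m²` for the powers of `p`
  refine ⟨26, fun p r t _ S _ hS σ => ?_⟩
  let _ : MulSemiringAction (Multiplicative ℕ) S := SkewBF.powAction σ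
  intro u m hm
  have h := hS.isChainRing
  refine ⟨SkewBF.exists_isRun p r u m, fun B hB => ⟨fun k hk => hB.isLeftGroebnerBasis h hk,
    hB.isLeftGroebnerBasis h le_rfl⟩, fun B hB => ?_, fun L c hL => ?_⟩
  · obtain ⟨s, c, hs, hsB⟩ := SkewBF.exists_stateBefore_of_isRun h hB le_rfl
    exact ⟨s.2, c + 0, ⟨s, c, 0, hs, ⟨rfl, rfl⟩, rfl⟩, hsB⟩
  · obtain ⟨s, c, _, hs, ⟨rfl, rfl⟩, rfl⟩ := hL
    obtain ⟨-, hlen, -, hB, hc⟩ := SkewBF.exists_isRun_of_stateBefore h hs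
    refine ⟨hB, hlen, ?_⟩
    have : r * 1 ≤ r * m ^ 2 := Nat.mul_le_mul_left r (Nat.one_le_pow _ _ hm)
    linarith
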